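/- **Setting.** A transmitter sends $\mathbf x\in\mathbb C^2$ over a non-coherent block-fading channel with coherence time $T=2$ and $N=1$ receive antenna; the receiver observes $\mathbf y=\sqrt{2\rho}\,h\,\mathbf x+\mathbf z\in\mathbb C^2$, where $\rho\ge 0$ is the signal-to-noise ratio, $h\sim\mathcal{CN}(0,1)$ is unknown to both ends, and $\mathbf z$ has i.i.d. $\mathcal{CN}(0,1)$ entries; $\mathbf x$, $h$ and $\mathbf z$ are independent. Let $\mathcal N$ be the cumulative distribution function of the standard real normal distribution. The cube-split constellation $CS(2,1)$ consists of the $8$ unit vectors $g_i(\mathbf a)$, $i\in\{1,2\}$, $\mathbf a=(a_1,a_2)\in\{\tfrac14,\tfrac34\}^2$, where $$g_1(\mathbf a)=\frac{(1,t)}{\sqrt{1+|t|^2}},\qquad g_2(\mathbf a)=\frac{(t,1)}{\sqrt{1+|t|^2}},\qquad t=\sqrt{\frac{1-e^{-|w|^2/2}}{1+e^{-|w|^2/2}}}\,\frac{w}{|w|},\qquad w=\mathcal N^{-1}(a_1)+\jmath\,\mathcal N^{-1}(a_2).$$ The transmitted symbol $\mathbf x=g_i(\mathbf a)$ is uniformly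 distributed on $CS(2,1)$. The greedy decoder computes a unit vector $\mathbf u$ maximizing $|\mathbf y^{\mathsf H}\mathbf u|$, sets $\hat i=\arg\min_{j}\sqrt{1-|u_j|^2}=\arg\max_j|u_j|$, forms $t=u_{3-\hat i}/u_{\hat i}$, $w=\sqrt{2\log\frac{1+|t|^2}{1-|t|^2}}\,\frac{t}{|t|}$, $\tilde a_1=\mathcal N(\Re w)$, $\tilde a_2=\mathcal N(\Im w)$, lets $\hat a_j$ be a point of $\{\tfrac14,\tfrac34\}$ closest to $\tilde a_j$, and outputs $\hat{\mathbf x}=g_{\hat i}(\hat{\mathbf a})$; ties are broken arbitrarily. Let $$P_e=\Pr\{\hat i\ne i\}+\big(1-\Pr\{\hat i\ne i\}\big)\Pr\{\hat{\mathbf a}\ne\mathbf a\mid\hat i=i\}$$ be the symbol error probability, and put $m=\mathcal N^{-1}(3/4)$, $c=\frac{1-e^{-m^2}}{1+e^{-m^2}}$, $\rho_0=\frac{2\rho}{1+c}$, $$D=\sqrt{(2+(1+c)\rho_0)^2-4c\rho_0^2},\qquad E=\sqrt{1+(1+c)\rho_0+\tfrac c2\rho_0^2},$$ $$A_1=\operatorname{arccot}\frac{1+\big(c-\sqrt{c/2}\big)\rho_0}{E},\qquad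 A_2=\operatorname{arccot}\frac{2+\big(1-2\sqrt{2c}+c\big)\rho_0}{D},$$ where $\operatorname{arccot}$ takes values in $(0,\pi)$. **Statement.** 1. The cell error probability is $\displaystyle \Pr\{\hat i\ne i\}=\frac12\Big(1-\frac{(1-c)\rho_0}{D}\Big)$. 2. The conditional coordinate error probability is $$\Pr\{\hat{\mathbf a}\ne\mathbf a\mid\hat i=i\}=1-\Big(1+\frac{(1-c)\rho_0}{D}\Big)^{-1}\Big(\frac14+\frac{\sqrt{2c}\,\rho_0A_1}{\pi E}+\frac{(1-c)\rho_0A_2}{\pi D}\Big).$$ 3. The union bound on $P_e$ over the $T-1=1$ pairs of local coordinates is tight: $$P_e=\Pr\{\hat i\ne i\}+(T-1)\big(1-\Pr\{\hat i\ne i\}\big)\Pr\{(\hat a_1,\hat a_2)\ne(a_1,a_2)\mid\hat i=i\}.$$ 4. The symbol error probability satisfies $P_e=\Pr\{\hat{\mathbf x}\ne\mathbf x\}$ and equals $$P_e=\frac78-\frac{\sqrt c\,\rho_0A_1}{\pi\sqrt{2+2(1+c)\rho_0+c\rho_0^2}}-\frac{(1-c)\rho_0A_2}{2\pi D}.$$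 -/

import Mathlib

open MeasureTheory ProbabilityTheory
open scoped Matrix

noncomputable section

namespace CubeSplit

/-- The cumulative distribution function of the standard real normal distribution. -/
def normalCDF (x : ℝ) : ℝ := cdf (gaussianReal 0 1) x

/-- The inverse of the standard normal cumulative distribution function (only used on `(0,1)`). -/
def normalInv (p : ℝ) : ℝ := Function.invFun normalCDF p

/-- The inverse cotangent, with values in `(0, π)`. -/
def arccot (x : ℝ) : ℝ := Real.pi / 2 - Real.arctan x

/-- The circularly symmetric complex Gaussian law `CN(0,1)`: the real and imaginary parts are
independent centered real Gaussians of variance `1/2`. -/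
def complexGaussian : Measure ℂ :=
  ((gaussianReal 0 (1 / 2)).prod (gaussianReal 0 (1 / 2))).map
    (fun p : ℝ × ℝ => (p.1 : ℂ) + (p.2 : ℂ) * Complex.I)

/-- The chordal distance between the lines spanned by two unit vectors. -/
def chordalDist {ι : Type*} [Fintype ι] (x y : EuclideanSpace ℂ ι) : ℝ :=
  Real.sqrt (1 - ‖inner ℂ x y‖ ^ 2)

/-! ### The constellation

The block length is `T = n + 1`.  The `2(T-1)` local coordinates are indexed by `Fin n × Fin 2`:
the pair `(j, 0), (j, 1)` determines the `j`-th complex coordinate. -/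

/-- The `2 ^ b` coordinate values `1/2^(b+1), 3/2^(b+1), …, (2^(b+1)-1)/2^(b+1)`. -/
def coordSet (b : ℕ) : Set ℝ := {x | ∃ k : ℕ, k < 2 ^ b ∧ x = (2 * k + 1) / 2 ^ (b + 1)}

/-- The map from `(0,1)²` to the unit disc. -/
def xi (a₁ a₂ : ℝ) : ℂ :=
  let w : ℂ := (normalInv a₁ : ℂ) + (normalInv a₂ : ℂ) * Complex.I
  (Real.sqrt ((1 - Real.exp (-(‖w‖ ^ 2 / 2))) / (1 + Real.exp (-(‖w‖ ^ 2 / 2)))) : ℂ) *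
    (w / (‖w‖ : ℂ))

/-- The vector `t` of the `T - 1` complex local coordinates. -/
def localCoord {n : ℕ} (a : Fin n × Fin 2 → ℝ) (j : Fin n) : ℂ := xi (a (j, 0)) (a (j, 1))

/-- The symbol `g_i(a) = (1 + ∑ |t_j|²)^(-1/2) [t_1, …, t_{i-1}, 1, t_i, …, t_{T-1}]`. -/
def symbol {n : ℕ} (i : Fin (n + 1)) (a : Fin n × Fin 2 → ℝ) :
    EuclideanSpace ℂ (Fin (n + 1)) :=
  WithLp.toLp 2 fun k =>
    (Fin.insertNth (α := fun _ => ℂ) i 1 (localCoord a) k) /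
      (Real.sqrt (1 + ∑ j, ‖localCoord a j‖ ^ 2) : ℂ)

/-- The inverse map `g_i⁻¹`, through `t_j = x_l / x_i` and
`w_j = √(2 log ((1+|t_j|²)/(1-|t_j|²))) t_j / |t_j|`. -/
def symbolInv {n : ℕ} (i : Fin (n + 1)) (x : EuclideanSpace ℂ (Fin (n + 1))) :
    Fin n × Fin 2 → ℝ := fun p =>
  let t : ℂ := x (i.succAbove p.1) / x i
  let w : ℂ := (Real.sqrt (2 * Real.log ((1 + ‖t‖ ^ 2) / (1 - ‖t‖ ^ 2))) : ℂ) * (t / (‖t‖ : ℂ))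
  if p.2 = 0 then normalCDF w.re else normalCDF w.im

/-- The labels (cell index, local coordinates) of the constellation with `B j` bits for the
`j`-th local coordinate. -/
def labels {n : ℕ} (B : Fin n × Fin 2 → ℕ) : Set (Fin (n + 1) × (Fin n × Fin 2 → ℝ)) :=
  {p | ∀ j, p.2 j ∈ coordSet (B j)}

/-! ### The channel -/

/-- The received matrix `Y = √(ρT) x hᵀ + Z`, of size `T × N`. -/
def received {n N : ℕ} (ρ : ℝ) (x : EuclideanSpace ℂ (Fin (n + 1))) (h : Fin N → ℂ)
    (Z : Fin (n + 1) → Fin N → ℂ) : Matrix (Fin (n + 1)) (Fin N) ℂ :=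
  Matrix.of fun k l => (Real.sqrt (ρ * (n + 1)) : ℂ) * x k * h l + Z k l

/-- The random data of one block: the label `(i, a)` is uniform, the entries of the channel
vector `h` and of the noise `Z` are `CN(0,1)`, and all of these are independent. -/
structure IsTransmission {Ω : Type*} [MeasurableSpace Ω] (μ : Measure Ω) {n N : ℕ}
    (B : Fin n × Fin 2 → ℕ) (i : Ω → Fin (n + 1)) (a : Ω → Fin n × Fin 2 → ℝ)
    (h : Ω → Fin N → ℂ) (Z : Ω → Fin (n + 1) → Fin N → ℂ) : Prop where
  measurable_i : Measurable i
  measurable_a : Measurable a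
  measurable_h : Measurable h
  measurable_Z : Measurable Z
  law : μ.map (fun ω => ((i ω, a ω), (h ω, Z ω))) =
    (uniformOn (labels B)).prod
      ((Measure.pi fun _ => complexGaussian).prod
        (Measure.pi fun _ => Measure.pi fun _ => complexGaussian))

/-! ### The greedy decoder -/

/-- The possible outcomes of the greedy decoder on the observation `y`.  Step 1: `u` is a unit
vector that maximizes `‖yᴴ u‖`.  Step 2: `iHat` is the index of a canonical basis vector closest
to `u`, and each `aHat j` is an element of the coordinate set closest to the `j`-th coordinate of
`g_iHat⁻¹(u)`.  Ties, and the phase of `u`, are resolved arbitrarily. -/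
structure IsGreedyDecoding {n N : ℕ} (B : Fin n × Fin 2 → ℕ)
    (y : Matrix (Fin (n + 1)) (Fin N) ℂ) (u : EuclideanSpace ℂ (Fin (n + 1)))
    (iHat : Fin (n + 1)) (aHat : Fin n × Fin 2 → ℝ) : Prop where
  norm_eq : ‖u‖ = 1
  isMax : ∀ v : EuclideanSpace ℂ (Fin (n + 1)), ‖v‖ = 1 →
    ‖WithLp.toLp 2 (yᴴ *ᵥ v.ofLp)‖ ≤ ‖WithLp.toLp 2 (yᴴ *ᵥ u.ofLp)‖
  cell : ∀ j, chordalDist u (EuclideanSpace.single iHat 1) ≤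
    chordalDist u (EuclideanSpace.single j 1)
  coord_mem : ∀ j, aHat j ∈ coordSet (B j)
  coord_le : ∀ j, ∀ b ∈ coordSet (B j),
    |symbolInv iHat u j - aHat j| ≤ |symbolInv iHat u j - b|

/-! ### Error probabilities -/

section Errors

variable {Ω : Type*} [MeasurableSpace Ω] (μ : Measure Ω) {n : ℕ}
  (i : Ω → Fin (n + 1)) (a : Ω → Fin n × Fin 2 → ℝ)
  (iHat : Ω → Fin (n + 1)) (aHat : Ω → Fin n × Fin 2 → ℝ)

/-- The cell error probability. -/
def cellError : ℝ := μ.real {ω | iHat ω ≠ i ω}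

/-- The probability of a coordinate error given correct cell detection. -/
def coordError : ℝ := (cond μ {ω | iHat ω = i ω}).real {ω | aHat ω ≠ a ω}

/-- The probability of an error in the `j`-th pair of local coordinates given correct cell
detection. -/
def pairError (j : Fin n) : ℝ :=
  (cond μ {ω | iHat ω = i ω}).real
    {ω | (aHat ω (j, 0), aHat ω (j, 1)) ≠ (a ω (j, 0), a ω (j, 1))}

/-- The symbol error probability. -/
def symbolError : ℝ :=
  cellError μ i iHat + (1 - cellError μ i iHat) * coordError μ i a iHat aHat

end Errors

/-- `c = (1 - e^{-m²}) / (1 + e^{-m²})` with `m` the `3/4`-quantile of the standard normal law. -/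
def cConst : ℝ :=
  (1 - Real.exp (-(normalInv (3 / 4)) ^ 2)) / (1 + Real.exp (-(normalInv (3 / 4)) ^ 2))

/-- `ρ₀ = ρT / (1 + (T-1)c)` with `T = n + 1`. -/
def rhoZero (n : ℕ) (ρ : ℝ) : ℝ := ρ * (n + 1) / (1 + n * cConst)

end CubeSplit

end

/-!
The decoder sees the observation `y ∈ ℂ²` only up to a scalar factor: by the equality case of the
Cauchy-Schwarz inequality the maximizing direction is `y / ‖y‖`, up to phase. Its decisions thus
depend on a ratio of the two samples only. When the label `(i, a)` is sent, let `z` be the sample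
outside cell `i` divided by the sample in cell `i`. The cell is decoded correctly iff `|z| < 1`, and
then each coordinate, `1/4` or `3/4`, is decoded as the sign of the real or imaginary part of `z`,
because the normal distribution function takes the value `1/2` at `0`. So the label is decoded
correctly iff `z` lies in one quadrant of the unit disc (`IsGreedyDecoding.correct_iff`), up to
ties, which have probability zero.

The point `t` of the constellation in local coordinates has modulus `√c` and lies on the bisector of
that quadrant (`xi_eq`). The two samples are `√s h + z₁` and `√s t h + z₂` with `s = ρ₀`, and
integrating out first `h` and then the common scale of the samples yields the density
`Δ / (π q(z)²)` of the ratio, with `q(z) = 1 + s c - 2 s Re (t̄ z) + (1 + s) |z|²` and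
`Δ = 1 + s + s c` (`lintegral_ratio`).

This density is the divergence of the smooth field `(1 + s) (z - z₀) / (2π q(z))`, where `z₀` is the
minimum point of `q`. Green's theorem (`integral_sector`) hence reduces the probability of a sector
symmetric about `t` to elementary integrals over its boundary. For the disc only the circle remains,
giving the term with `D` of the cell error; for the quadrant, the arc contributes `A₂` and the two
sides contribute `A₁`. All labels lead to the same two values, and the stated identities are
algebra in these (`IsTransmission.measure_ratio_mem` and the final theorem).
-/

namespace CubeSplit

open scoped ENNReal ComplexConjugate

/-! ### Green's theorem on a sector and the boundary integrals -/

open Real in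
/-- The quadratic in `r` has the negative discriminant `4 (β² cos² φ - αγ)`. -/
theorem polarForm_pos {α β γ : ℝ} (hγ : 0 < γ) (h : β ^ 2 < α * γ) (φ r : ℝ) :
    0 < α - 2 * β * r * cos φ + γ * r ^ 2 := by
  have h1 : β ^ 2 * cos φ ^ 2 ≤ β ^ 2 := by
    have := cos_sq_le_one φ
    nlinarith [sq_nonneg β]
  have h2 : 0 < γ * (α - 2 * β * r * cos φ + γ * r ^ 2) := by
    nlinarith [sq_nonneg (γ * r - β * cos φ)]
  exact pos_of_mul_pos_right h2 hγ.le

open Real in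
/-- The radial component, multiplied by `r`, of the vector field whose divergence is the density of
`integral_sector`, with its `r`-derivative. -/
theorem hasDerivAt_radialField {α β γ : ℝ} (hγ : 0 < γ) (h : β ^ 2 < α * γ) (φ r : ℝ) :
    HasDerivAt
      (fun r => (γ * r ^ 2 - β * r * cos φ) / (2 * π * (α - 2 * β * r * cos φ + γ * r ^ 2)))
      (((2 * γ * r - β * cos φ) * (α - 2 * β * r * cos φ + γ * r ^ 2)
        - 2 * r * (γ * r - β * cos φ) ^ 2)
        / (2 * π * (α - 2 * β * r * cos φ + γ * r ^ 2) ^ 2)) r := by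
  have hq := (polarForm_pos hγ h φ r).ne'
  have h1 : HasDerivAt (fun r : ℝ => γ * r ^ 2 - β * r * cos φ) (γ * (2 * r) - β * cos φ) r := by
    simpa using ((hasDerivAt_pow 2 r).const_mul γ).fun_sub
      (((hasDerivAt_id r).const_mul β).mul_const (cos φ))
  have h2 : HasDerivAt (fun r : ℝ => 2 * π * (α - 2 * β * r * cos φ + γ * r ^ 2))
      (2 * π * (-(2 * β * cos φ) + γ * (2 * r))) r := by
    have := ((((hasDerivAt_id r).const_mul (2 * β)).mul_const (cos φ)).const_sub α).fun_add
      ((hasDerivAt_pow 2 r).const_mul γ)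
    simpa using this.const_mul (2 * π)
  refine (h1.div h2 (by positivity)).congr_deriv ?_
  field_simp
  ring

open Real in
/-- The angular component of the vector field whose divergence is the density of
`integral_sector`, with its `φ`-derivative. -/
theorem hasDerivAt_angularField {α β γ : ℝ} (hγ : 0 < γ) (h : β ^ 2 < α * γ) (r φ : ℝ) :
    HasDerivAt (fun φ => β * sin φ / (2 * π * (α - 2 * β * r * cos φ + γ * r ^ 2)))
      ((β * cos φ * (α - 2 * β * r * cos φ + γ * r ^ 2) - 2 * r * (β * sin φ) ^ 2)
        / (2 * π * (α - 2 * β * r * cos φ + γ * r ^ 2) ^ 2)) φ := by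
  have hq := (polarForm_pos hγ h φ r).ne'
  have h1 : HasDerivAt (fun φ : ℝ => β * sin φ) (β * cos φ) φ := (hasDerivAt_sin φ).const_mul β
  have h2 : HasDerivAt (fun φ : ℝ => 2 * π * (α - 2 * β * r * cos φ + γ * r ^ 2))
      (2 * π * (2 * β * r * sin φ)) φ := by
    have := ((((hasDerivAt_cos φ).const_mul (2 * β * r))).const_sub α).add_const (γ * r ^ 2)
    simpa using this.const_mul (2 * π)
  refine (h1.div h2 (by positivity)).congr_deriv ?_
  field_simp

open Real in
/-- The two values of the arctangent primitive combine into one `arccot` by the addition formula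
for the cotangent; no branch correction occurs since their difference lies in `(0, π)`. -/
theorem integral_one_div_quadratic {α b γ E : ℝ} (hγ : 0 < γ) (hE : 0 < E)
    (h : E ^ 2 = α * γ - b ^ 2) :
    ∫ r in (0 : ℝ)..1, 1 / (α - 2 * b * r + γ * r ^ 2) = arccot ((α - b) / E) / E := by
  have hpos : ∀ r, 0 < α - 2 * b * r + γ * r ^ 2 := fun r => by
    have h2 : 0 < γ * (α - 2 * b * r + γ * r ^ 2) := by
      nlinarith [sq_nonneg (γ * r - b), pow_pos hE 2]
    exact pos_of_mul_pos_right h2 hγ.le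
  have hd : ∀ r, HasDerivAt (fun r => arctan ((γ * r - b) / E) / E)
      (1 / (α - 2 * b * r + γ * r ^ 2)) r := by
    intro r
    have h1 : HasDerivAt (fun r => (γ * r - b) / E) (γ / E) r := by
      simpa using (((hasDerivAt_id r).const_mul γ).sub_const b).div_const E
    refine (h1.arctan.div_const E).congr_deriv ?_
    have h3 : 1 + ((γ * r - b) / E) ^ 2 = γ * (α - 2 * b * r + γ * r ^ 2) / E ^ 2 := by
      rw [div_pow, eq_div_iff (by positivity), add_mul, div_mul_cancel₀ _ (by positivity), h]
      ring
    have := (hpos r).ne'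
    rw [h3]
    field_simp
  rw [intervalIntegral.integral_eq_sub_of_hasDerivAt (fun r _ => hd r)
    (Continuous.intervalIntegrable
      (Continuous.div (by fun_prop) (by fun_prop) fun r => (hpos r).ne') _ _), ← sub_div]
  congr 1
  have hp : arctan ((γ * 0 - b) / E) < arctan ((γ * 1 - b) / E) := by
    apply arctan_strictMono
    gcongr
    simp
  set x := arctan ((γ * 1 - b) / E) with hx
  set y := arctan ((γ * 0 - b) / E) with hy
  have hne : x - y ≠ 0 := by linarith
  rw [arccot, eq_sub_iff_add_eq, ← eq_sub_iff_add_eq']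
  apply arctan_eq_of_tan_eq
  · have hcx : cos x ≠ 0 := cos_arctan_pos _ |>.ne'
    have hcy : cos y ≠ 0 := cos_arctan_pos _ |>.ne'
    have htx : sin x = (γ * 1 - b) / E * cos x := by
      rw [← tan_mul_cos hcx, hx, tan_arctan]
    have hty : sin y = (γ * 0 - b) / E * cos y := by
      rw [← tan_mul_cos hcy, hy, tan_arctan]
    rw [tan_pi_div_two_sub, tan_eq_sin_div_cos, inv_div, sin_sub, cos_sub, htx, hty]
    have : (γ * 1 - b) / E * cos x * cos y - cos x * ((γ * 0 - b) / E * cos y) ≠ 0 := by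
      have : (γ * 1 - b) / E * cos x * cos y - cos x * ((γ * 0 - b) / E * cos y)
        = γ / E * (cos x * cos y) := by ring
      rw [this]; positivity
    rw [div_eq_iff this]
    field_simp
    linear_combination h
  · constructor
    · have := arctan_lt_pi_div_two ((γ * 1 - b) / E)
      have := neg_pi_div_two_lt_arctan ((γ * 0 - b) / E)
      linarith
    · linarith

open Real in
/-- The primitive used is the integrated Poisson kernel, which unlike the half-angle substitution is
smooth on the whole circle. -/
theorem integral_circle {A B D : ℝ} (hA : 0 < A) (hD : 0 < D) (h : D ^ 2 = A ^ 2 - B ^ 2) :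
    ∫ φ in -π..π, 1 / (A - B * cos φ) = 2 * π / D := by
  have hAB : |B| < A := abs_lt_of_sq_lt_sq (by nlinarith) hA.le
  have hB : ∀ φ, B * cos φ ≤ |B| := fun φ => by
    calc B * cos φ ≤ |B * cos φ| := le_abs_self _
      _ = |B| * |cos φ| := abs_mul _ _
      _ ≤ |B| * 1 := by gcongr; exact abs_cos_le_one φ
      _ = |B| := mul_one _
  have hd : ∀ φ, HasDerivAt (fun φ => (φ + 2 * arctan (B * sin φ / (A + D - B * cos φ))) / D)
      (1 / (A - B * cos φ)) φ := by
    intro φ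
    have h1 : A - B * cos φ ≠ 0 := by linarith [hB φ]
    have h2 : A + D - B * cos φ ≠ 0 := by linarith [hB φ]
    have h3 : HasDerivAt (fun φ => B * sin φ / (A + D - B * cos φ))
        ((B * cos φ * (A + D - B * cos φ) - B * sin φ * (B * sin φ))
          / (A + D - B * cos φ) ^ 2) φ := by
      refine ((hasDerivAt_sin φ).const_mul B).div ?_ h2
      simpa using ((hasDerivAt_cos φ).const_mul B).const_sub (A + D)
    refine (((hasDerivAt_id φ).add (h3.arctan.const_mul 2)).div_const D).congr_deriv ?_
    have hs : sin φ ^ 2 = 1 - cos φ ^ 2 := sin_sq φ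
    have h4 : 1 + (B * sin φ / (A + D - B * cos φ)) ^ 2 =
        2 * (A + D) * (A - B * cos φ) / (A + D - B * cos φ) ^ 2 := by
      rw [div_pow, eq_div_iff (by positivity), add_mul, div_mul_cancel₀ _ (by positivity),
        mul_pow, hs]
      linear_combination h
    have h5 : A + D ≠ 0 := by positivity
    rw [h4]
    field_simp
    linear_combination (-B ^ 2) * hs - h
  rw [intervalIntegral.integral_eq_sub_of_hasDerivAt (fun r _ => hd r)
    (Continuous.intervalIntegrable
      (Continuous.div (by fun_prop) (by fun_prop) fun φ => by linarith [hB φ]) _ _)]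
  simp
  ring

open Real in
/-- Half-angle substitution, then `tan (π / 8) = √2 - 1` and the double-angle formula. -/
theorem integral_quarter_arc {A B D : ℝ} (hA : 0 < A) (hB : 0 ≤ B) (hD : 0 < D)
    (h : D ^ 2 = A ^ 2 - B ^ 2) :
    ∫ φ in -(π / 4)..π / 4, 1 / (A - B * cos φ) = 2 * arccot ((A - √2 * B) / D) / D := by
  have hBA : B < A := by nlinarith
  have hB1 : ∀ φ, B * cos φ < A := fun φ => by
    nlinarith [mul_le_mul_of_nonneg_left (cos_le_one φ) hB]
  have hmem : ∀ φ ∈ Set.uIcc (-(π / 4)) (π / 4), cos (φ / 2) ≠ 0 := by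
    intro φ hφ
    rw [Set.uIcc_of_le (by linarith [pi_pos])] at hφ
    exact (cos_pos_of_mem_Ioo ⟨by linarith [pi_pos, hφ.1], by linarith [pi_pos, hφ.2]⟩).ne'
  have hd : ∀ φ ∈ Set.uIcc (-(π / 4)) (π / 4),
      HasDerivAt (fun φ => 2 * arctan ((A + B) / D * tan (φ / 2)) / D)
      (1 / (A - B * cos φ)) φ := by
    intro φ hφ
    have hc := hmem φ hφ
    have h1 : A - B * cos φ ≠ 0 := by linarith [hB1 φ]
    have h3 : HasDerivAt (fun φ => (A + B) / D * tan (φ / 2))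
        ((A + B) / D * (1 / cos (φ / 2) ^ 2 * (1 / 2))) φ := by
      have := (hasDerivAt_tan hc).comp φ ((hasDerivAt_id φ).div_const 2)
      exact this.const_mul _
    refine ((h3.arctan.const_mul 2).div_const D).congr_deriv ?_
    have hs : sin (φ / 2) ^ 2 = 1 - cos (φ / 2) ^ 2 := sin_sq _
    have hc2 : cos φ = 2 * cos (φ / 2) ^ 2 - 1 := by rw [← cos_two_mul]; ring_nf
    have h4 : 1 + ((A + B) / D * tan (φ / 2)) ^ 2 =
        (A + B) * (A - B * cos φ) / (D * cos (φ / 2)) ^ 2 := by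
      rw [tan_eq_sin_div_cos, div_mul_div_comm, div_pow, eq_div_iff (by positivity), add_mul,
        div_mul_cancel₀ _ (by positivity), mul_pow, mul_pow, hs, hc2, h]
      ring
    have h5 : A + B ≠ 0 := by positivity
    rw [h4]
    field_simp
  rw [intervalIntegral.integral_eq_sub_of_hasDerivAt hd
    (Continuous.intervalIntegrable
      (Continuous.div (by fun_prop) (by fun_prop) fun φ => by linarith [hB1 φ]) _ _), ← sub_div]
  congr 1
  rw [neg_div, tan_neg, mul_neg, arctan_neg]
  set t := tan (π / 4 / 2)
  have ht0 : 0 < t := tan_pos_of_pos_of_lt_pi_div_two (by positivity) (by linarith [pi_pos])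
  have ht : t = √2 - 1 := by
    have h1 : tan (2 * (π / 4 / 2)) = 1 := by
      rw [← tan_pi_div_four]; ring_nf
    rw [tan_two_mul] at h1
    have h2 : 2 * t / (1 - t ^ 2) = 1 := h1
    have h3 : (1 - t ^ 2) ≠ 0 := by
      intro h0; simp [h0] at h2
    rw [div_eq_one_iff_eq h3] at h2
    rw [eq_sub_iff_add_eq, eq_comm, sqrt_eq_iff_mul_self_eq (by positivity) (by positivity)]
    linear_combination -h2
  set x := arctan ((A + B) / D * t) with hx
  suffices arctan ((A - √2 * B) / D) = π / 2 - 2 * x by rw [arccot, this]; ring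
  have hx0 : 0 < x := arctan_pos.2 (by positivity)
  have hx1 := arctan_lt_pi_div_two ((A + B) / D * t)
  apply arctan_eq_of_tan_eq
  · have hs : √2 = t + 1 := by linarith
    have ht2 : t ^ 2 + 2 * t = 1 := by
      have h2 : √2 ^ 2 = 2 := by norm_num
      rw [hs] at h2
      linear_combination h2
    rw [tan_pi_div_two_sub, tan_two_mul, hx, tan_arctan, inv_div,
      eq_comm, eq_div_iff (show 2 * ((A + B) / D * t) ≠ 0 by positivity), hs]
    have e1 : (A - (t + 1) * B) / D * (2 * ((A + B) / D * t)) =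
        2 * (A - (t + 1) * B) * (A + B) * t / D ^ 2 := by ring
    have e2 : 1 - ((A + B) / D * t) ^ 2 = (D ^ 2 - (A + B) ^ 2 * t ^ 2) / D ^ 2 := by
      field_simp
    rw [e1, e2, h]
    congr 1
    linear_combination (A + B) * (A - B) * ht2
  · constructor <;> linarith

open Real in
set_option maxHeartbeats 400000 in
/-- Green's theorem for the circular sector of radius `1` and half-angle `θ`. With
`q = α - 2βr cos φ + γr²`, the field `γ (z - β/γ) / (2π q)`, which is radial about the centre `β/γ`
of the level circles of `q`, is smooth and has divergence `(αγ - β²) / (π q²)`. Its flux through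
the arc gives the first two terms, its flux through the two straight sides the last one. -/
theorem integral_sector {α β γ : ℝ} (hγ : 0 < γ) (h : β ^ 2 < α * γ) (θ : ℝ) :
    ∫ φ in -θ..θ, ∫ r in (0 : ℝ)..1,
        r * ((α * γ - β ^ 2) / (π * (α - 2 * β * r * cos φ + γ * r ^ 2) ^ 2)) =
      θ / (2 * π) + (γ - α) / (4 * π) * (∫ φ in -θ..θ, 1 / (α + γ - 2 * β * cos φ))
        + β * sin θ / π * ∫ r in (0 : ℝ)..1, 1 / (α - 2 * β * r * cos θ + γ * r ^ 2) := by
  have hpos := polarForm_pos hγ h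
  have hne := fun φ r => (hpos φ r).ne'
  obtain ⟨F, hF⟩ : ∃ F : ℝ → ℝ → ℝ, F = fun φ r =>
    ((2 * γ * r - β * cos φ) * (α - 2 * β * r * cos φ + γ * r ^ 2)
        - 2 * r * (γ * r - β * cos φ) ^ 2)
        / (2 * π * (α - 2 * β * r * cos φ + γ * r ^ 2) ^ 2) := ⟨_, rfl⟩
  obtain ⟨G, hG⟩ : ∃ G : ℝ → ℝ → ℝ, G = fun φ r =>
    (β * cos φ * (α - 2 * β * r * cos φ + γ * r ^ 2) - 2 * r * (β * sin φ) ^ 2)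
        / (2 * π * (α - 2 * β * r * cos φ + γ * r ^ 2) ^ 2) := ⟨_, rfl⟩
  have hFc : Continuous (Function.uncurry F) := by
    simp only [hF, Function.uncurry_def]
    refine Continuous.div (by fun_prop) (by fun_prop) fun x => ?_
    have := hpos x.1 x.2
    positivity
  have hGc : Continuous (Function.uncurry G) := by
    simp only [hG, Function.uncurry_def]
    refine Continuous.div (by fun_prop) (by fun_prop) fun x => ?_
    have := hpos x.1 x.2
    positivity
  have hF1 : ∀ φ, Continuous (F φ) := fun φ => hFc.comp (by fun_prop : Continuous fun r => (φ, r))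
  have hG1 : ∀ φ, Continuous (G φ) := fun φ => hGc.comp (by fun_prop : Continuous fun r => (φ, r))
  have hG2 : ∀ r, Continuous fun φ => G φ r := fun r =>
    hGc.comp (by fun_prop : Continuous fun φ => (φ, r))
  -- `F` and `G` are the two partial derivatives, so `F + G` is the divergence times `r`.
  have hsplit : ∀ φ r, r * ((α * γ - β ^ 2) / (π * (α - 2 * β * r * cos φ + γ * r ^ 2) ^ 2)) =
      F φ r + G φ r := by
    intro φ r
    have := hne φ r
    simp only [hF, hG]
    rw [← add_div, ← mul_div_assoc, div_eq_div_iff (by positivity) (by positivity)]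
    have hs : sin φ ^ 2 = 1 - cos φ ^ 2 := sin_sq φ
    rw [mul_pow, hs]
    ring
  have hFint : ∀ φ, ∫ r in (0 : ℝ)..1, F φ r =
      1 / (4 * π) + (γ - α) / (4 * π) * (1 / (α + γ - 2 * β * cos φ)) := by
    intro φ
    rw [hF, intervalIntegral.integral_eq_sub_of_hasDerivAt
      (fun r _ => hasDerivAt_radialField hγ h φ r) ((hF ▸ hF1 φ).intervalIntegrable _ _)]
    have h1 := hne φ 1
    have h2 : α + γ - 2 * β * cos φ ≠ 0 := by
      intro h0; apply h1; linear_combination h0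
    have h3 : α - 2 * β * 1 * cos φ + γ * 1 ^ 2 = α + γ - 2 * β * cos φ := by ring
    rw [h3]
    have h4 : β * cos φ = (α + γ - (α + γ - 2 * β * cos φ)) / 2 := by ring
    generalize α + γ - 2 * β * cos φ = w at h2 h4 ⊢
    simp only [mul_one, one_pow, h4]
    field_simp
    ring
  have hGint : ∀ r, ∫ φ in -θ..θ, G φ r =
      β * sin θ / π * (1 / (α - 2 * β * r * cos θ + γ * r ^ 2)) := by
    intro r
    rw [hG, intervalIntegral.integral_eq_sub_of_hasDerivAt
      (fun φ _ => hasDerivAt_angularField hγ h r φ) ((hG ▸ hG2 r).intervalIntegrable _ _)]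
    have h1 := hne θ r
    rw [sin_neg, cos_neg]
    field_simp
    ring
  have hcirc : Continuous fun φ => 1 / (α + γ - 2 * β * cos φ) := by
    refine Continuous.div (by fun_prop) (by fun_prop) fun φ => ?_
    intro h0; apply hne φ 1; linear_combination h0
  calc _ = ∫ φ in -θ..θ, ((∫ r in (0 : ℝ)..1, F φ r) + ∫ r in (0 : ℝ)..1, G φ r) := by
        refine intervalIntegral.integral_congr fun φ _ => ?_
        simp only [hsplit]
        exact intervalIntegral.integral_add ((hF1 φ).intervalIntegrable _ _)
          ((hG1 φ).intervalIntegrable _ _)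
    _ = (∫ φ in -θ..θ, ∫ r in (0 : ℝ)..1, F φ r) + ∫ φ in -θ..θ, ∫ r in (0 : ℝ)..1, G φ r :=
        intervalIntegral.integral_add
          ((intervalIntegral.continuous_parametric_intervalIntegral_of_continuous'
            hFc 0 1).intervalIntegrable _ _)
          ((intervalIntegral.continuous_parametric_intervalIntegral_of_continuous'
            hGc 0 1).intervalIntegrable _ _)
    _ = (∫ φ in -θ..θ, (1 / (4 * π) + (γ - α) / (4 * π) * (1 / (α + γ - 2 * β * cos φ))))
        + ∫ r in (0 : ℝ)..1, ∫ φ in -θ..θ, G φ r := by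
        simp only [hFint]
        congr 1
        refine intervalIntegral_intervalIntegral_swap ?_
        have h1 : IntegrableOn (Function.uncurry G) (Set.uIcc (-θ) θ ×ˢ Set.uIcc 0 1) :=
          hGc.continuousOn.integrableOn_compact (isCompact_uIcc.prod isCompact_uIcc)
        have h2 := h1.mono_set (Set.prod_mono Set.uIoc_subset_uIcc Set.uIoc_subset_uIcc)
        exact h2
    _ = _ := by
        simp only [hGint]
        rw [intervalIntegral.integral_add (by simp) ((hcirc.const_mul _).intervalIntegrable _ _),
          intervalIntegral.integral_const_mul, intervalIntegral.integral_const_mul,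
          intervalIntegral.integral_const]
        have hθ : (θ - -θ) • (1 / (4 * π)) = θ / (2 * π) := by
          rw [smul_eq_mul]; field_simp; ring
        rw [hθ]

/-! ### The law of the ratio of the received samples -/

/-- `CN(0,1)` has density `π⁻¹ exp (-|z|²)` on `ℂ`. -/
theorem complexGaussian_eq_withDensity :
    complexGaussian =
      volume.withDensity fun z : ℂ => ENNReal.ofReal (Real.pi⁻¹ * Real.exp (-‖z‖ ^ 2)) := by
  have hmp := Complex.volume_preserving_equiv_real_prod.symm
  have hfun : (fun p : ℝ × ℝ => (p.1 : ℂ) + (p.2 : ℂ) * Complex.I) =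
      Complex.measurableEquivRealProd.symm := by
    ext p
    simp [Complex.measurableEquivRealProd_symm_apply, Complex.mk_eq_add_mul_I]
  have hm : Measurable fun z : ℂ => ENNReal.ofReal (Real.pi⁻¹ * Real.exp (-‖z‖ ^ 2)) := by
    fun_prop
  ext S hS
  rw [complexGaussian, gaussianReal_of_var_ne_zero _ (by norm_num),
    prod_withDensity (measurable_gaussianPDF _ _) (measurable_gaussianPDF _ _), hfun,
    MeasurableEquiv.map_apply, withDensity_apply _ (by measurability), withDensity_apply _ hS,
    ← hmp.setLIntegral_comp_preimage hS hm]
  refine lintegral_congr fun p => ?_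
  rw [← hfun, gaussianPDF, gaussianPDF, ← ENNReal.ofReal_mul (gaussianPDFReal_nonneg _ _ _)]
  congr 1
  simp only [gaussianPDFReal]
  rw [← Complex.normSq_eq_norm_sq, Complex.normSq_add_mul_I]
  have h1 : 2 * Real.pi * ((1 / 2 : NNReal) : ℝ) = Real.pi := by push_cast; ring
  have h2 : 2 * ((1 / 2 : NNReal) : ℝ) = 1 := by push_cast; ring
  rw [h1, h2]
  have h3 : (√Real.pi)⁻¹ * (√Real.pi)⁻¹ = Real.pi⁻¹ := by
    rw [← mul_inv, Real.mul_self_sqrt Real.pi_pos.le]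
  rw [mul_mul_mul_comm, h3, ← Real.exp_add]
  congr 2
  ring

theorem lintegral_exp_neg_mul_norm_sq {b : ℝ} (hb : 0 < b) :
    ∫⁻ z : ℂ, ENNReal.ofReal (Real.exp (-b * ‖z‖ ^ 2)) = ENNReal.ofReal (Real.pi / b) := by
  have h := Complex.integral_rpow_mul_exp_neg_mul_rpow (p := 2) (q := 0) (b := b)
    (by norm_num) (by norm_num) hb
  have h' : ∫ z : ℂ, Real.exp (-b * ‖z‖ ^ 2) = Real.pi / b := by
    rw [mul_div_cancel_left₀ _ two_ne_zero] at h
    simpa [Real.rpow_neg hb.le, div_eq_mul_inv] using h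
  rw [← h', ofReal_integral_eq_lintegral_ofReal]
  · exact Integrable.of_integral_ne_zero (by rw [h']; positivity)
  · exact .of_forall fun z => (Real.exp_pos _).le

theorem lintegral_norm_sq_mul_exp_neg_mul_norm_sq {b : ℝ} (hb : 0 < b) :
    ∫⁻ z : ℂ, ENNReal.ofReal (‖z‖ ^ 2 * Real.exp (-b * ‖z‖ ^ 2)) =
      ENNReal.ofReal (Real.pi / b ^ 2) := by
  have h := Complex.integral_rpow_mul_exp_neg_mul_rpow (p := 2) (q := 2) (b := b)
    (by norm_num) (by norm_num) hb
  have h' : ∫ z : ℂ, ‖z‖ ^ 2 * Real.exp (-b * ‖z‖ ^ 2) = Real.pi / b ^ 2 := by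
    have e : -(2 + 2 : ℝ) / 2 = -(2 : ℕ) := by norm_num
    have e2 : (2 + 2 : ℝ) / 2 = 2 := by norm_num
    rw [e, e2, mul_div_cancel_left₀ _ two_ne_zero, Real.rpow_neg hb.le, Real.rpow_natCast,
      Real.Gamma_two] at h
    simpa [div_eq_mul_inv] using h
  rw [← h', ofReal_integral_eq_lintegral_ofReal]
  · exact Integrable.of_integral_ne_zero (by rw [h']; positivity)
  · exact .of_forall fun z => mul_nonneg (by positivity) (Real.exp_pos _).le

theorem lintegral_comp_unit_mul (f : ℂ → ℝ≥0∞) {a : ℂ} (ha : ‖a‖ = 1) :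
    ∫⁻ z, f (a * z) = ∫⁻ z, f z := by
  let e := rotation ⟨a, mem_sphere_zero_iff_norm.2 ha⟩
  exact e.measurePreserving.lintegral_comp_emb e.toHomeomorph.measurableEmbedding f

/-- The complex substitution `z ↦ a z` has real Jacobian `|a|²`. -/
theorem lintegral_eq_norm_sq_mul_lintegral_comp_mul (f : ℂ → ℝ≥0∞) {a : ℂ} (ha : a ≠ 0) :
    ∫⁻ z, f z = ENNReal.ofReal (‖a‖ ^ 2) * ∫⁻ z, f (a * z) := by
  have hn : ‖a‖ ≠ 0 := norm_ne_zero_iff.2 ha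
  have hunit : ‖a / ‖a‖‖ = 1 := by simp [hn]
  have h1 : ∀ z, a * z = (a / ‖a‖) * (‖a‖ • z) := by
    intro z
    have : (‖a‖ : ℂ) ≠ 0 := by exact_mod_cast hn
    rw [Complex.real_smul]
    field_simp
  have hemb : MeasurableEmbedding fun z : ℂ => ‖a‖ • z :=
    (Homeomorph.smulOfNeZero ‖a‖ hn).measurableEmbedding
  have h2 : ∫⁻ z, f (a * z) = ENNReal.ofReal ((‖a‖ ^ 2)⁻¹) * ∫⁻ z, f ((a / ‖a‖) * z) := by
    simp_rw [h1]
    rw [← hemb.lintegral_map (μ := volume) (fun z => f (a / ‖a‖ * z)),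
      Measure.map_addHaar_smul volume hn, lintegral_smul_measure, Complex.finrank_real_complex,
      abs_of_nonneg (by positivity)]
    rfl
  rw [h2, lintegral_comp_unit_mul f hunit, ← mul_assoc, ← ENNReal.ofReal_mul (by positivity),
    mul_inv_cancel₀ (by positivity), ENNReal.ofReal_one, one_mul]

/-- The density of the ratio `(√s t h + z₂) / (√s h + z₁)` for independent `CN(0,1)` variables
`h`, `z₁`, `z₂`. It is the constant `1 + s + s|t|²`, the determinant of the covariance matrix of
denominator and numerator, divided by `π` times the square of the adjugate form of that matrix at
`(1, z)`. -/
noncomputable def ratioDensity (s : ℝ) (t z : ℂ) : ℝ :=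
  (1 + s + s * ‖t‖ ^ 2) /
    (Real.pi * (1 + s * ‖t‖ ^ 2 - 2 * s * (conj t * z).re + (1 + s) * ‖z‖ ^ 2) ^ 2)

/-- Integrating out the fading coefficient `h` by completing the square gives the joint density of
the two received samples. -/
theorem lintegral_fading {s : ℝ} (hs : 0 ≤ s) (t x y : ℂ) :
    ∫⁻ h : ℂ, ENNReal.ofReal (Real.pi⁻¹ * Real.exp (-‖h‖ ^ 2)) *
        (ENNReal.ofReal (Real.pi⁻¹ * Real.exp (-‖x - √s * h‖ ^ 2)) *
          ENNReal.ofReal (Real.pi⁻¹ * Real.exp (-‖y - √s * t * h‖ ^ 2))) =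
      ENNReal.ofReal ((Real.pi ^ 2 * (1 + s + s * ‖t‖ ^ 2))⁻¹ *
        Real.exp (-(‖x‖ ^ 2 + ‖y‖ ^ 2 - s * ‖x + conj t * y‖ ^ 2 / (1 + s + s * ‖t‖ ^ 2)))) := by
  set Δ := 1 + s + s * ‖t‖ ^ 2 with hΔ
  have hΔ0 : 0 < Δ := by positivity
  set m : ℂ := √s * (x + conj t * y) / Δ with hm
  have hss : √s * √s = s := Real.mul_self_sqrt hs
  -- The square is completed around the conditional mean `m` of `h` given the two samples.
  have key : ∀ h : ℂ, -‖h‖ ^ 2 + (-‖x - √s * h‖ ^ 2 + -‖y - √s * t * h‖ ^ 2) =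
      -(‖x‖ ^ 2 + ‖y‖ ^ 2 - s * ‖x + conj t * y‖ ^ 2 / Δ) + -Δ * ‖h - m‖ ^ 2 := by
    intro h
    have hΔm : m * Δ = √s * (x + conj t * y) := by
      rw [hm, div_mul_cancel₀]; exact_mod_cast hΔ0.ne'
    have hmre := congrArg Complex.re hΔm
    have hmim := congrArg Complex.im hΔm
    have h1 : s * ‖x + conj t * y‖ ^ 2 / Δ = Δ * ‖m‖ ^ 2 := by
      rw [hm, norm_div, norm_mul, Complex.norm_real, Complex.norm_real, div_pow, mul_pow,
        Real.norm_of_nonneg (Real.sqrt_nonneg s), Real.norm_of_nonneg hΔ0.le, Real.sq_sqrt hs]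
      field_simp
    rw [h1]
    simp only [← Complex.normSq_eq_norm_sq, Complex.normSq_apply] at hΔ ⊢
    simp only [Complex.add_re, Complex.add_im, Complex.mul_re, Complex.mul_im, Complex.sub_re,
      Complex.sub_im, Complex.ofReal_re, Complex.ofReal_im, Complex.conj_re, Complex.conj_im,
      mul_zero, zero_mul, sub_zero, add_zero, zero_add] at hmre hmim ⊢
    generalize √s = q at *
    linear_combination (-2 * h.re) * hmre + (-2 * h.im) * hmim +
      (h.re ^ 2 + h.im ^ 2) * hΔ - (h.re ^ 2 + h.im ^ 2) * (1 + t.re ^ 2 + t.im ^ 2) * hss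
  have hint : ∀ h : ℂ, ENNReal.ofReal (Real.pi⁻¹ * Real.exp (-‖h‖ ^ 2)) *
        (ENNReal.ofReal (Real.pi⁻¹ * Real.exp (-‖x - √s * h‖ ^ 2)) *
          ENNReal.ofReal (Real.pi⁻¹ * Real.exp (-‖y - √s * t * h‖ ^ 2))) =
      ENNReal.ofReal (Real.pi⁻¹ ^ 3 *
        Real.exp (-(‖x‖ ^ 2 + ‖y‖ ^ 2 - s * ‖x + conj t * y‖ ^ 2 / Δ))) *
        ENNReal.ofReal (Real.exp (-Δ * ‖h - m‖ ^ 2)) := by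
    intro h
    rw [← ENNReal.ofReal_mul (by positivity), ← ENNReal.ofReal_mul (by positivity),
      ← ENNReal.ofReal_mul (by positivity), mul_assoc (Real.pi⁻¹ ^ 3), ← Real.exp_add, ← key h,
      Real.exp_add, Real.exp_add]
    congr 1
    ring
  simp_rw [hint]
  rw [lintegral_const_mul' _ _ ENNReal.ofReal_ne_top,
    lintegral_sub_right_eq_self (fun h : ℂ => ENNReal.ofReal (Real.exp (-Δ * ‖h‖ ^ 2))) m,
    lintegral_exp_neg_mul_norm_sq hΔ0, ← ENNReal.ofReal_mul (by positivity)]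
  congr 1
  field_simp

theorem ratioForm_pos {s : ℝ} (hs : 0 ≤ s) (t z : ℂ) :
    0 < 1 + s * ‖t‖ ^ 2 - 2 * s * (conj t * z).re + (1 + s) * ‖z‖ ^ 2 := by
  have h : (conj t * z).re ≤ ‖t‖ * ‖z‖ := by
    calc _ ≤ ‖conj t * z‖ := Complex.re_le_norm _
      _ = _ := by simp
  nlinarith [mul_le_mul_of_nonneg_left h hs, mul_nonneg hs (sq_nonneg (‖t‖ - ‖z‖)), sq_nonneg ‖z‖]

/-- Integrating the joint density of the samples `(x, x z)`, with the Jacobian `|x|²`, over `x`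
leaves the density of the ratio. -/
theorem lintegral_radius {s : ℝ} (hs : 0 ≤ s) (t z : ℂ) :
    ∫⁻ x : ℂ, ENNReal.ofReal (‖x‖ ^ 2) * ENNReal.ofReal ((Real.pi ^ 2 * (1 + s + s * ‖t‖ ^ 2))⁻¹ *
        Real.exp (-(‖x‖ ^ 2 + ‖x * z‖ ^ 2
          - s * ‖x + conj t * (x * z)‖ ^ 2 / (1 + s + s * ‖t‖ ^ 2)))) =
      ENNReal.ofReal (ratioDensity s t z) := by
  set Δ := 1 + s + s * ‖t‖ ^ 2 with hΔ
  have hΔ0 : 0 < Δ := by positivity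
  set q := 1 + s * ‖t‖ ^ 2 - 2 * s * (conj t * z).re + (1 + s) * ‖z‖ ^ 2 with hq
  have hq0 : 0 < q := ratioForm_pos hs t z
  have key : ∀ x : ℂ, -(‖x‖ ^ 2 + ‖x * z‖ ^ 2 - s * ‖x + conj t * (x * z)‖ ^ 2 / Δ) =
      -(q / Δ) * ‖x‖ ^ 2 := by
    intro x
    have h1 : x + conj t * (x * z) = x * (1 + conj t * z) := by ring
    have h2 : ‖1 + conj t * z‖ ^ 2 = 1 + 2 * (conj t * z).re + ‖t‖ ^ 2 * ‖z‖ ^ 2 := by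
      rw [← Complex.normSq_eq_norm_sq, Complex.normSq_add]
      simp [Complex.normSq_eq_norm_sq]
      ring
    rw [h1, norm_mul, norm_mul, mul_pow, mul_pow, h2]
    field_simp
    rw [hΔ, hq]
    ring
  have hint : ∀ x : ℂ, ENNReal.ofReal (‖x‖ ^ 2) * ENNReal.ofReal ((Real.pi ^ 2 * Δ)⁻¹ *
        Real.exp (-(‖x‖ ^ 2 + ‖x * z‖ ^ 2 - s * ‖x + conj t * (x * z)‖ ^ 2 / Δ))) =
      ENNReal.ofReal ((Real.pi ^ 2 * Δ)⁻¹) *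
        ENNReal.ofReal (‖x‖ ^ 2 * Real.exp (-(q / Δ) * ‖x‖ ^ 2)) := by
    intro x
    rw [key x, ← ENNReal.ofReal_mul (by positivity), ← ENNReal.ofReal_mul (by positivity)]
    congr 1
    ring
  simp_rw [hint]
  rw [lintegral_const_mul' _ _ ENNReal.ofReal_ne_top,
    lintegral_norm_sq_mul_exp_neg_mul_norm_sq (by positivity), ← ENNReal.ofReal_mul (by positivity)]
  congr 1
  rw [ratioDensity, ← hq, ← hΔ]
  field_simp

/-- The ratio of the two received samples has density `ratioDensity s t`. -/
theorem lintegral_ratio {s : ℝ} (hs : 0 ≤ s) (t : ℂ) {J : ℂ → ℝ≥0∞} (hJ : Measurable J) :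
    ∫⁻ p, J ((√s * t * p.1 + p.2.2) / (√s * p.1 + p.2.1))
        ∂(complexGaussian.prod (complexGaussian.prod complexGaussian)) =
      ∫⁻ z, J z * ENNReal.ofReal (ratioDensity s t z) := by
  set g : ℂ → ℝ≥0∞ := fun z => ENNReal.ofReal (Real.pi⁻¹ * Real.exp (-‖z‖ ^ 2)) with hg
  have hgm : Measurable g := by rw [hg]; fun_prop
  have hKm : Measurable fun p : ℂ × ℂ =>
      ENNReal.ofReal ((Real.pi ^ 2 * (1 + s + s * ‖t‖ ^ 2))⁻¹ *
        Real.exp (-(‖p.1‖ ^ 2 + ‖p.2‖ ^ 2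
          - s * ‖p.1 + conj t * p.2‖ ^ 2 / (1 + s + s * ‖t‖ ^ 2)))) := by fun_prop
  set K : ℂ → ℂ → ℝ≥0∞ := fun x y => ENNReal.ofReal ((Real.pi ^ 2 * (1 + s + s * ‖t‖ ^ 2))⁻¹ *
        Real.exp (-(‖x‖ ^ 2 + ‖y‖ ^ 2
          - s * ‖x + conj t * y‖ ^ 2 / (1 + s + s * ‖t‖ ^ 2)))) with hK
  rw [complexGaussian_eq_withDensity, prod_withDensity hgm hgm, prod_withDensity hgm (by fun_prop),
    lintegral_withDensity_eq_lintegral_mul _ (by fun_prop) (by fun_prop)]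
  calc _ = ∫⁻ h, ∫⁻ x, ∫⁻ y, g h * (g x * g y) * J ((√s * t * h + y) / (√s * h + x)) := by
        rw [lintegral_prod _ (by fun_prop)]
        refine lintegral_congr fun h => ?_
        rw [lintegral_prod _ (by fun_prop)]
        rfl
    -- Pass from the noise to the received samples `x`, `y` by translation.
    _ = ∫⁻ h, ∫⁻ x, ∫⁻ y, J (y / x) * (g h * (g (x - √s * h) * g (y - √s * t * h))) := by
        refine lintegral_congr fun h => ?_
        rw [← lintegral_sub_right_eq_self _ (√s * h : ℂ)]
        refine lintegral_congr fun x => ?_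
        rw [← lintegral_sub_right_eq_self _ (√s * t * h : ℂ)]
        refine lintegral_congr fun y => ?_
        rw [add_sub_cancel, add_sub_cancel, mul_comm]
    _ = ∫⁻ x, ∫⁻ y, ∫⁻ h, J (y / x) * (g h * (g (x - √s * h) * g (y - √s * t * h))) := by
        rw [lintegral_lintegral_swap]
        · refine lintegral_congr fun x => ?_
          rw [lintegral_lintegral_swap]
          apply Measurable.aemeasurable
          simp only [Function.uncurry_def]
          fun_prop
        · apply Measurable.aemeasurable
          apply Measurable.lintegral_prod_right'
            (f := fun p : (ℂ × ℂ) × ℂ => J (p.2 / p.1.2) *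
              (g p.1.1 * (g (p.1.2 - √s * p.1.1) * g (p.2 - √s * t * p.1.1))))
          fun_prop
    _ = ∫⁻ x, ∫⁻ y, J (y / x) * K x y := by
        refine lintegral_congr fun x => lintegral_congr fun y => ?_
        rw [lintegral_const_mul _ (by fun_prop), lintegral_fading hs]
    -- Substitute `y = x z`, so that `z` is the ratio of the samples.
    _ = ∫⁻ x, ∫⁻ z, J z * (ENNReal.ofReal (‖x‖ ^ 2) * K x (x * z)) := by
        have h0 : ∀ᵐ x : ℂ, x ≠ 0 := by simp [ae_iff]
        refine lintegral_congr_ae (h0.mono fun x hx => ?_)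
        dsimp only
        rw [lintegral_eq_norm_sq_mul_lintegral_comp_mul _ hx,
          ← lintegral_const_mul' _ _ ENNReal.ofReal_ne_top]
        refine lintegral_congr fun z => ?_
        rw [mul_div_cancel_left₀ _ hx, mul_left_comm]
    _ = ∫⁻ z, ∫⁻ x, J z * (ENNReal.ofReal (‖x‖ ^ 2) * K x (x * z)) := by
        rw [lintegral_lintegral_swap]
        apply Measurable.aemeasurable
        simp only [Function.uncurry_def, hK]
        fun_prop
    _ = _ := by
        refine lintegral_congr fun z => ?_
        rw [lintegral_const_mul _ (by simp only [hK]; fun_prop), lintegral_radius hs]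

/-! ### Sector probabilities -/

/-- In polar coordinates around the direction `τ` of `t`, the density of the ratio depends on the
angle only through its cosine. -/
theorem ratioDensity_polar (s : ℝ) {t τ : ℂ} (ht : t = ‖t‖ * τ) (hτ : ‖τ‖ = 1) {r : ℝ} (hr : 0 ≤ r)
    (φ : ℝ) :
    ratioDensity s t (τ * (r * (Real.cos φ + Real.sin φ * Complex.I))) =
      ((1 + s * ‖t‖ ^ 2) * (1 + s) - (s * ‖t‖) ^ 2) /
        (Real.pi * (1 + s * ‖t‖ ^ 2 - 2 * (s * ‖t‖) * r * Real.cos φ + (1 + s) * r ^ 2) ^ 2) := by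
  have h1 : ‖(r * (Real.cos φ + Real.sin φ * Complex.I) : ℂ)‖ = r := by
    rw [norm_mul, Complex.norm_real, Real.norm_of_nonneg hr, Complex.ofReal_cos, Complex.ofReal_sin,
      Complex.norm_cos_add_sin_mul_I, mul_one]
  have h2 : (conj t * (τ * (r * (Real.cos φ + Real.sin φ * Complex.I)))).re =
      ‖t‖ * r * Real.cos φ := by
    have h3 : conj τ * τ = 1 := by rw [Complex.conj_mul', hτ]; simp
    have h4 : conj t * (τ * (r * (Real.cos φ + Real.sin φ * Complex.I))) =
        ((‖t‖ * r : ℝ) : ℂ) * (Real.cos φ + Real.sin φ * Complex.I) := by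
      conv_lhs => rw [ht]
      push_cast
      rw [map_mul, Complex.conj_ofReal]
      linear_combination (‖t‖ : ℂ) * r * (Complex.cos φ + Complex.sin φ * Complex.I) * h3
    rw [h4, Complex.re_ofReal_mul]
    simp [Complex.cos_ofReal_re]
  rw [ratioDensity, h2, norm_mul, hτ, h1]
  congr 1
  · ring
  · ring

/-- The probability that the ratio falls into a set that, up to a null set, is the sector of radius
`1` and half-angle `θ` about the direction of `t`, as an iterated integral in polar coordinates. -/
theorem setLIntegral_ratioDensity {s : ℝ} (hs : 0 ≤ s) {t τ : ℂ} (ht : t = ‖t‖ * τ) (hτ : ‖τ‖ = 1)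
    {θ : ℝ} (hθ : 0 ≤ θ) (hθπ : θ ≤ Real.pi) {S : Set ℂ} (hS : MeasurableSet S)
    (hmem : ∀ r φ : ℝ, 0 < r → φ ∈ Set.Ioo (-Real.pi) Real.pi →
      (τ * (r * (Real.cos φ + Real.sin φ * Complex.I)) ∈ S ↔ r < 1 ∧ φ ∈ Set.Ioo (-θ) θ)) :
    ∫⁻ z in S, ENNReal.ofReal (ratioDensity s t z) =
      ENNReal.ofReal (∫ φ in -θ..θ, ∫ r in (0 : ℝ)..1,
        r * (((1 + s * ‖t‖ ^ 2) * (1 + s) - (s * ‖t‖) ^ 2) /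
          (Real.pi * (1 + s * ‖t‖ ^ 2 - 2 * (s * ‖t‖) * r * Real.cos φ
            + (1 + s) * r ^ 2) ^ 2))) := by
  set f : ℝ → ℝ → ℝ := fun r φ => r * (((1 + s * ‖t‖ ^ 2) * (1 + s) - (s * ‖t‖) ^ 2) /
          (Real.pi * (1 + s * ‖t‖ ^ 2 - 2 * (s * ‖t‖) * r * Real.cos φ
            + (1 + s) * r ^ 2) ^ 2)) with hf
  have hΔ : (s * ‖t‖) ^ 2 < (1 + s * ‖t‖ ^ 2) * (1 + s) := by
    nlinarith [mul_nonneg hs (sq_nonneg ‖t‖)]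
  have hfc : Continuous (Function.uncurry f) := by
    simp only [hf, Function.uncurry_def]
    refine continuous_fst.mul (Continuous.div (by fun_prop) (by fun_prop) fun p => ?_)
    have := polarForm_pos (by positivity : 0 < 1 + s) hΔ p.2 p.1
    positivity
  have hf0 : ∀ p ∈ Set.Ioo (0 : ℝ) 1 ×ˢ Set.Ioo (-θ) θ, 0 ≤ Function.uncurry f p := by
    intro p hp
    have h1 := hp.1.1
    have h2 := sub_pos.2 hΔ
    simp only [hf, Function.uncurry_def]
    positivity
  have hfi : IntegrableOn (Function.uncurry f) (Set.uIcc 0 1 ×ˢ Set.uIcc (-θ) θ) :=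
    hfc.continuousOn.integrableOn_compact (isCompact_uIcc.prod isCompact_uIcc)
  have hsub : Set.Ioo (0 : ℝ) 1 ×ˢ Set.Ioo (-θ) θ ⊆ Set.uIcc 0 1 ×ˢ Set.uIcc (-θ) θ :=
    Set.prod_mono (Set.Ioo_subset_Icc_self.trans Set.Icc_subset_uIcc)
      (Set.Ioo_subset_Icc_self.trans Set.Icc_subset_uIcc)
  have hms : MeasurableSet (Set.Ioo (0 : ℝ) 1 ×ˢ Set.Ioo (-θ) θ) :=
    measurableSet_Ioo.prod measurableSet_Ioo
  calc _ = ∫⁻ z, S.indicator (fun z => ENNReal.ofReal (ratioDensity s t z)) (τ * z) := by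
        rw [lintegral_comp_unit_mul _ hτ, lintegral_indicator hS]
    _ = ∫⁻ p in polarCoord.target, (Set.Ioo (0 : ℝ) 1 ×ˢ Set.Ioo (-θ) θ).indicator
          (fun p => ENNReal.ofReal (Function.uncurry f p)) p := by
        rw [← Complex.lintegral_comp_polarCoord_symm]
        refine setLIntegral_congr_fun polarCoord.open_target.measurableSet fun p hp => ?_
        have hp1 : 0 < p.1 := hp.1
        have hp2 : p.2 ∈ Set.Ioo (-Real.pi) Real.pi := hp.2
        rw [Complex.polarCoord_symm_apply]
        simp only [smul_eq_mul]
        have := hmem p.1 p.2 hp1 hp2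
        by_cases h : p ∈ Set.Ioo (0 : ℝ) 1 ×ˢ Set.Ioo (-θ) θ
        · rw [Set.indicator_of_mem h, Set.indicator_of_mem (this.2 ⟨h.1.2, h.2⟩),
            ratioDensity_polar s ht hτ hp1.le, ← ENNReal.ofReal_mul hp1.le]
          rfl
        · rw [Set.indicator_of_notMem h, Set.indicator_of_notMem, mul_zero]
          exact fun h' => h ⟨⟨hp1, (this.1 h').1⟩, (this.1 h').2⟩
    _ = ∫⁻ p in Set.Ioo (0 : ℝ) 1 ×ˢ Set.Ioo (-θ) θ, ENNReal.ofReal (Function.uncurry f p) := by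
        rw [lintegral_indicator hms, Measure.restrict_restrict hms, Set.inter_eq_left.2]
        intro p hp
        exact ⟨hp.1.1, ⟨by linarith [hp.2.1], by linarith [hp.2.2]⟩⟩
    _ = ENNReal.ofReal (∫ p in Set.Ioo (0 : ℝ) 1 ×ˢ Set.Ioo (-θ) θ, Function.uncurry f p) :=
        (ofReal_integral_eq_lintegral_ofReal (hfi.mono_set hsub)
          ((ae_restrict_iff' hms).2 (.of_forall hf0))).symm
    _ = ENNReal.ofReal (∫ r in (0 : ℝ)..1, ∫ φ in -θ..θ, f r φ) := by
        rw [Measure.volume_eq_prod, setIntegral_prod _ (hfi.mono_set hsub),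
          intervalIntegral.integral_of_le zero_le_one, integral_Ioc_eq_integral_Ioo]
        simp_rw [intervalIntegral.integral_of_le (show -θ ≤ θ by linarith),
          integral_Ioc_eq_integral_Ioo]
        rfl
    _ = _ := by
        rw [intervalIntegral_intervalIntegral_swap (hfi.mono_set
          (Set.prod_mono Set.uIoc_subset_uIcc Set.uIoc_subset_uIcc))]

/-- The probability that the ratio lies in the unit disc, i.e. that the cell is detected
correctly. -/
theorem lintegral_ratioDensity_disc {s c D : ℝ} (hs : 0 ≤ s) {t : ℂ} (ht0 : t ≠ 0)
    (hc : ‖t‖ ^ 2 = c) (hD : D = √((2 + (1 + c) * s) ^ 2 - 4 * c * s ^ 2)) :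
    ∫⁻ z in {z : ℂ | ‖z‖ < 1}, ENNReal.ofReal (ratioDensity s t z) =
      ENNReal.ofReal (1 / 2 * (1 + (1 - c) * s / D)) := by
  have hn : (‖t‖ : ℂ) ≠ 0 := by simpa using ht0
  have hτ : ‖t / ‖t‖‖ = 1 := by simp [ht0]
  have hpi := Real.pi_pos
  rw [setLIntegral_ratioDensity hs (τ := t / ‖t‖) (by field_simp) hτ hpi.le le_rfl
    (measurableSet_lt measurable_norm measurable_const)]
  · have hc0 : 0 ≤ c := hc ▸ sq_nonneg _
    have hrad : 0 < (2 + (1 + c) * s) ^ 2 - 4 * c * s ^ 2 := by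
      nlinarith [mul_nonneg hc0 hs, mul_nonneg hs hs, sq_nonneg ((1 - c) * s)]
    have hD0 : 0 < D := hD ▸ Real.sqrt_pos.2 hrad
    have hD2 : D ^ 2 = (2 + (1 + c) * s) ^ 2 - 4 * c * s ^ 2 := by
      rw [hD, Real.sq_sqrt hrad.le]
    rw [integral_sector (by positivity) (by nlinarith [mul_nonneg hs (sq_nonneg ‖t‖)]),
      integral_circle (D := D) (by positivity) hD0
        (by rw [hD2, hc]; linear_combination (4 * s ^ 2) * hc),
      Real.sin_pi, hc]
    congr 1
    field_simp
    ring
  · intro r φ hr hφ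
    rw [Set.mem_ofPred_eq, norm_mul, hτ, one_mul, norm_mul, Complex.norm_real,
      Real.norm_of_nonneg hr.le, Complex.ofReal_cos, Complex.ofReal_sin,
      Complex.norm_cos_add_sin_mul_I, mul_one]
    exact (and_iff_left hφ).symm

theorem abs_lt_pi_div_four_iff {φ : ℝ} (hφ : φ ∈ Set.Ioo (-Real.pi) Real.pi) :
    φ ∈ Set.Ioo (-(Real.pi / 4)) (Real.pi / 4) ↔ |Real.sin φ| < Real.cos φ := by
  have hpi := Real.pi_pos
  have h1 : |φ| < Real.pi := abs_lt.2 hφ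
  have h2 : |φ| < Real.pi / 4 ↔ Real.cos (Real.pi / 4) < Real.cos |φ| :=
    (Real.strictAntiOn_cos.lt_iff_gt ⟨by positivity, by linarith⟩ ⟨abs_nonneg _, h1.le⟩).symm
  have h3 : √2 ^ 2 = 2 := by norm_num
  have h4 := Real.sin_sq_add_cos_sq φ
  have h5 : 0 < √2 := by positivity
  rw [Set.mem_Ioo, ← abs_lt, h2, Real.cos_abs, Real.cos_pi_div_four]
  constructor
  · intro h
    apply abs_lt_of_sq_lt_sq <;> nlinarith
  · intro h
    have h6 := sq_lt_sq' (by linarith [abs_nonneg (Real.sin φ)]) h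
    rw [sq_abs] at h6
    have h7 : 0 < Real.cos φ := (abs_nonneg _).trans_lt h
    nlinarith

/-- Rotating by the direction of the bisector turns the quadrant with signs `σ₁`, `σ₂` into the
sector `|φ| < π / 4`. -/
theorem mem_quadrant_iff {σ₁ σ₂ : ℝ} (h₁ : σ₁ ^ 2 = 1) (h₂ : σ₂ ^ 2 = 1) {r φ : ℝ} (hr : 0 < r)
    (hφ : φ ∈ Set.Ioo (-Real.pi) Real.pi) :
    (((σ₁ + σ₂ * Complex.I) / √2 : ℂ) * (r * (Real.cos φ + Real.sin φ * Complex.I)) ∈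
        {z : ℂ | ‖z‖ < 1 ∧ 0 < σ₁ * z.re ∧ 0 < σ₂ * z.im}) ↔
      r < 1 ∧ φ ∈ Set.Ioo (-(Real.pi / 4)) (Real.pi / 4) := by
  have hn : ‖((σ₁ + σ₂ * Complex.I) / √2 : ℂ)‖ = 1 := by
    rw [norm_div, Complex.norm_add_mul_I, h₁, h₂, Complex.norm_real,
      Real.norm_of_nonneg (Real.sqrt_nonneg _)]
    norm_num
  rw [Set.mem_ofPred_eq, norm_mul, hn, one_mul, norm_mul, Complex.norm_real,
      Real.norm_of_nonneg hr.le, Complex.ofReal_cos, Complex.ofReal_sin,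
      Complex.norm_cos_add_sin_mul_I, mul_one, abs_lt_pi_div_four_iff hφ]
  refine and_congr_right fun _ => ?_
  have h5 : 0 < √2 := by positivity
  have e : ((σ₁ + σ₂ * Complex.I) / √2 : ℂ) * (r * (Complex.cos φ + Complex.sin φ * Complex.I)) =
      ((r / √2 * (σ₁ * Real.cos φ - σ₂ * Real.sin φ) : ℝ) : ℂ) +
      ((r / √2 * (σ₁ * Real.sin φ + σ₂ * Real.cos φ) : ℝ) : ℂ) * Complex.I := by
    push_cast
    linear_combination (r * σ₂ * Complex.sin φ / √2 : ℂ) * Complex.I_sq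
  have e1 : σ₁ * (r / √2 * (σ₁ * Real.cos φ - σ₂ * Real.sin φ)) =
      r / √2 * (Real.cos φ - σ₁ * σ₂ * Real.sin φ) := by
    linear_combination r / √2 * Real.cos φ * h₁
  have e2 : σ₂ * (r / √2 * (σ₁ * Real.sin φ + σ₂ * Real.cos φ)) =
      r / √2 * (Real.cos φ + σ₁ * σ₂ * Real.sin φ) := by
    linear_combination r / √2 * Real.cos φ * h₂
  rw [e, Complex.add_re, Complex.add_im, Complex.re_ofReal_mul, Complex.im_ofReal_mul,
    Complex.ofReal_re, Complex.ofReal_im, Complex.I_re, Complex.I_im, mul_zero, add_zero, zero_add,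
    mul_one, e1, e2, mul_pos_iff_of_pos_left (by positivity),
    mul_pos_iff_of_pos_left (by positivity)]
  have h6 : |σ₁ * σ₂ * Real.sin φ| = |Real.sin φ| := by
    rw [← sq_eq_sq_iff_abs_eq_abs, mul_pow, mul_pow, h₁, h₂, one_mul, one_mul]
  rw [← h6, abs_lt, and_comm]
  exact and_congr ⟨fun h => by linarith, fun h => by linarith⟩
    ⟨fun h => by linarith, fun h => by linarith⟩

/-- The probability that the ratio lies in the quadrant of the unit disc whose bisector is the
direction of `t`, i.e. that the whole label is detected correctly. -/
theorem lintegral_ratioDensity_quadrant {s c D E : ℝ} (hs : 0 ≤ s) (hc : 0 ≤ c)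
    {σ₁ σ₂ : ℝ} (h₁ : σ₁ ^ 2 = 1) (h₂ : σ₂ ^ 2 = 1)
    (hD : D = √((2 + (1 + c) * s) ^ 2 - 4 * c * s ^ 2))
    (hE : E = √(1 + (1 + c) * s + c / 2 * s ^ 2)) :
    ∫⁻ z in {z : ℂ | ‖z‖ < 1 ∧ 0 < σ₁ * z.re ∧ 0 < σ₂ * z.im},
        ENNReal.ofReal (ratioDensity s (√c * ((σ₁ + σ₂ * Complex.I) / √2)) z) =
      ENNReal.ofReal (1 / 8
        + √(2 * c) * s * arccot ((1 + (c - √(c / 2)) * s) / E) / (2 * Real.pi * E)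
        + (1 - c) * s * arccot ((2 + (1 - 2 * √(2 * c) + c) * s) / D) / (2 * Real.pi * D)) := by
  have hn : ‖((σ₁ + σ₂ * Complex.I) / √2 : ℂ)‖ = 1 := by
    rw [norm_div, Complex.norm_add_mul_I, h₁, h₂, Complex.norm_real,
      Real.norm_of_nonneg (Real.sqrt_nonneg _)]
    norm_num
  have ht : ‖(√c * ((σ₁ + σ₂ * Complex.I) / √2) : ℂ)‖ = √c := by
    rw [norm_mul, hn, mul_one, Complex.norm_real, Real.norm_of_nonneg (Real.sqrt_nonneg _)]
  have hpi := Real.pi_pos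
  have hS : MeasurableSet {z : ℂ | ‖z‖ < 1 ∧ 0 < σ₁ * z.re ∧ 0 < σ₂ * z.im} := by
    measurability
  rw [setLIntegral_ratioDensity hs (τ := (σ₁ + σ₂ * Complex.I) / √2) (by rw [ht]) hn
    (θ := Real.pi / 4) (by positivity) (by linarith) hS
    (fun r φ hr hφ => mem_quadrant_iff h₁ h₂ hr hφ), ht]
  have hcc : √c ^ 2 = c := Real.sq_sqrt hc
  have hrad : 0 < (2 + (1 + c) * s) ^ 2 - 4 * c * s ^ 2 := by
    nlinarith [mul_nonneg hc hs, mul_nonneg hs hs, sq_nonneg ((1 - c) * s)]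
  have hD0 : 0 < D := hD ▸ Real.sqrt_pos.2 hrad
  have hD2 : D ^ 2 = (2 + (1 + c) * s) ^ 2 - 4 * c * s ^ 2 := by
    rw [hD, Real.sq_sqrt hrad.le]
  have hE0 : 0 < E := hE ▸ Real.sqrt_pos.2 (by positivity)
  have hE2 : E ^ 2 = 1 + (1 + c) * s + c / 2 * s ^ 2 := by
    rw [hE, Real.sq_sqrt (by positivity)]
  have h22 : √2 ^ 2 = 2 := by norm_num
  have hc2 : √(2 * c) = √2 * √c := Real.sqrt_mul (by norm_num) _
  have hc3 : √(c / 2) = √c * √2 / 2 := by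
    rw [Real.sqrt_div hc]; field_simp; linear_combination (-√c) * h22
  have hline : ∀ r : ℝ, 2 * (s * √c) * r * Real.cos (Real.pi / 4) = 2 * (s * √c * √2 / 2) * r := by
    intro r; rw [Real.cos_pi_div_four]; ring
  rw [integral_sector (by positivity) (by rw [mul_pow, hcc]; nlinarith [mul_nonneg hs hc]),
    integral_quarter_arc (D := D) (by positivity) (by positivity) hD0
      (by rw [hD2, hcc]; linear_combination (4 * s ^ 2) * hcc)]
  simp_rw [hline]
  rw [integral_one_div_quadratic (E := E) (by positivity) hE0
    (by rw [hE2, hcc]; linear_combination (s ^ 2 * √2 ^ 2 / 4) * hcc + (s ^ 2 * c / 4) * h22),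
    hcc, hc2, hc3,
    Real.sin_pi_div_four]
  have e1 : 1 + s * c - s * √c * √2 / 2 = 1 + (c - √c * √2 / 2) * s := by ring
  have e2 : 1 + s * c + (1 + s) - √2 * (2 * (s * √c)) = 2 + (1 - 2 * (√2 * √c) + c) * s := by ring
  rw [e1, e2]
  congr 1
  field_simp
  ring

/-! ### The normal distribution function and its quartiles -/

theorem strictMono_normalCDF : StrictMono normalCDF := by
  intro x y hxy
  simp only [normalCDF, cdf_eq_real]
  have h : (gaussianReal 0 1) (Set.Ioc x y) ≠ 0 := fun h0 => by
    have := gaussianReal_absolutelyContinuous' 0 one_ne_zero h0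
    simp [hxy.not_ge] at this
  have h' : 0 < (gaussianReal 0 1).real (Set.Ioc x y) :=
    ENNReal.toReal_pos h (measure_ne_top _ _)
  rw [← Set.Iic_union_Ioc_eq_Iic hxy.le,
    measureReal_union (Set.Iic_disjoint_Ioc le_rfl) measurableSet_Ioc]
  linarith

theorem continuous_normalCDF : Continuous normalCDF := by
  have := nullSingletonClass_gaussianReal (μ := 0) (v := 1) one_ne_zero
  refine continuous_iff_continuousAt.2 fun x => ?_
  have h := (cdf (gaussianReal 0 1)).measure_singleton x
  rw [measure_cdf, measure_singleton, eq_comm, ENNReal.ofReal_eq_zero, sub_nonpos] at h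
  have hm : Monotone (cdf (gaussianReal 0 1)) := monotone_cdf _
  refine (hm.continuousAt_iff_leftLim_eq_rightLim).2 ?_
  rw [StieltjesFunction.rightLim_eq]
  exact le_antisymm (hm.leftLim_le le_rfl) h

theorem normalCDF_neg (x : ℝ) : normalCDF (-x) = 1 - normalCDF x := by
  have := nullSingletonClass_gaussianReal (μ := 0) (v := 1) one_ne_zero
  simp only [normalCDF, cdf_eq_real]
  have h1 : (gaussianReal 0 1).real (Set.Iic (-x)) = (gaussianReal 0 1).real (Set.Ici x) := by
    have h := gaussianReal_map_neg (μ := 0) (v := 1)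
    rw [neg_zero] at h
    conv_lhs => rw [← h]
    rw [map_measureReal_apply measurable_neg measurableSet_Iic]
    congr 1
    ext y
    simp
  rw [h1, ← probReal_compl_eq_one_sub measurableSet_Iic, Set.compl_Iic]
  exact measureReal_congr Ioi_ae_eq_Ici.symm

theorem normalCDF_zero : normalCDF 0 = 1 / 2 := by
  have := normalCDF_neg 0
  rw [neg_zero] at this
  linarith

theorem normalInv_normalCDF (x : ℝ) : normalInv (normalCDF x) = x :=
  Function.leftInverse_invFun strictMono_normalCDF.injective x

theorem normalCDF_normalInv {p : ℝ} (h0 : 0 < p) (h1 : p < 1) : normalCDF (normalInv p) = p := by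
  have hr : p ∈ Set.range normalCDF :=
    mem_range_of_exists_le_of_exists_ge continuous_normalCDF
      (((tendsto_cdf_atBot (gaussianReal 0 1)).eventually (ge_mem_nhds h0)).exists)
      (((tendsto_cdf_atTop (gaussianReal 0 1)).eventually (le_mem_nhds h1)).exists)
  obtain ⟨x, rfl⟩ := hr
  rw [normalInv_normalCDF]

theorem normalInv_three_quarters_pos : 0 < normalInv (3 / 4) := by
  rw [← strictMono_normalCDF.lt_iff_lt, normalCDF_zero,
    normalCDF_normalInv (by norm_num) (by norm_num)]
  norm_num

/-- The symmetry of the normal law puts the two quartiles at opposite points. -/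
theorem normalInv_one_quarter : normalInv (1 / 4) = -normalInv (3 / 4) := by
  rw [← normalInv_normalCDF (-normalInv (3 / 4)), normalCDF_neg,
    normalCDF_normalInv (by norm_num) (by norm_num)]
  norm_num

theorem cConst_pos : 0 < cConst := by
  have h : Real.exp (-normalInv (3 / 4) ^ 2) < 1 := by
    rw [Real.exp_lt_one_iff]
    have := normalInv_three_quarters_pos
    nlinarith
  exact div_pos (by linarith) (by positivity)

theorem cConst_lt_one : cConst < 1 := by
  have := Real.exp_pos (-normalInv (3 / 4) ^ 2)
  rw [cConst, div_lt_one (by positivity)]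
  linarith

/-! ### The constellation with one bit per coordinate -/

/-- With one bit per coordinate, the coordinate values are the two quartile levels. -/
theorem mem_coordSet_one_iff {x : ℝ} : x ∈ coordSet 1 ↔ x = 1 / 4 ∨ x = 3 / 4 := by
  constructor
  · rintro ⟨k, hk, rfl⟩
    interval_cases k <;> norm_num
  · rintro (rfl | rfl)
    · exact ⟨0, by norm_num, by norm_num⟩
    · exact ⟨1, by norm_num, by norm_num⟩

/-- The sign by which a one-bit coordinate is encoded: `-1` for `1/4` and `1` for `3/4`. -/
def coordSign (x : ℝ) : ℝ := 4 * x - 2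

theorem coordSign_sq {x : ℝ} (hx : x ∈ coordSet 1) : coordSign x ^ 2 = 1 := by
  rcases mem_coordSet_one_iff.1 hx with rfl | rfl <;> norm_num [coordSign]

theorem coordSign_injective : Function.Injective coordSign := fun x y h => by
  simp only [coordSign] at h
  linarith

theorem normalInv_of_mem_coordSet {x : ℝ} (hx : x ∈ coordSet 1) :
    normalInv x = coordSign x * normalInv (3 / 4) := by
  rcases mem_coordSet_one_iff.1 hx with rfl | rfl
  · rw [normalInv_one_quarter]; norm_num [coordSign]
  · norm_num [coordSign]

theorem norm_coordSign_add {x y : ℝ} (hx : x ∈ coordSet 1) (hy : y ∈ coordSet 1) :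
    ‖(coordSign x + coordSign y * Complex.I : ℂ)‖ = √2 := by
  rw [Complex.norm_add_mul_I, coordSign_sq hx, coordSign_sq hy]
  norm_num

/-- The four local coordinates are the points of modulus `√c` on the bisectors of the quadrants. -/
theorem xi_eq {x y : ℝ} (hx : x ∈ coordSet 1) (hy : y ∈ coordSet 1) :
    xi x y = √cConst * ((coordSign x + coordSign y * Complex.I) / √2) := by
  have hm := normalInv_three_quarters_pos
  rw [xi, normalInv_of_mem_coordSet hx, normalInv_of_mem_coordSet hy, cConst]
  set m := normalInv (3 / 4)
  have hw : ((coordSign x * m : ℝ) : ℂ) + ((coordSign y * m : ℝ) : ℂ) * Complex.I =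
      m * (coordSign x + coordSign y * Complex.I) := by
    push_cast; ring
  have hnw : ‖(m * (coordSign x + coordSign y * Complex.I) : ℂ)‖ = m * √2 := by
    rw [norm_mul, norm_coordSign_add hx hy, Complex.norm_real, Real.norm_of_nonneg hm.le]
  simp only [hw, hnw]
  have hexp : (m * √2) ^ 2 / 2 = m ^ 2 := by
    rw [mul_pow, Real.sq_sqrt (by norm_num)]; ring
  rw [hexp]
  have hm' : (m : ℂ) ≠ 0 := by exact_mod_cast hm.ne'
  congr 1
  push_cast
  rw [mul_div_mul_left _ _ hm']

theorem norm_xi {x y : ℝ} (hx : x ∈ coordSet 1) (hy : y ∈ coordSet 1) :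
    ‖xi x y‖ = √cConst := by
  rw [xi_eq hx hy, norm_mul, norm_div, norm_coordSign_add hx hy, Complex.norm_real,
    Complex.norm_real, Real.norm_of_nonneg (Real.sqrt_nonneg _),
    Real.norm_of_nonneg (Real.sqrt_nonneg _), div_self (by positivity), mul_one]

theorem symbol_apply_self (i : Fin 2) {a : Fin 1 × Fin 2 → ℝ} (ha : ∀ j, a j ∈ coordSet 1) :
    symbol i a i = 1 / √(1 + cConst) := by
  simp [symbol, localCoord, norm_xi (ha _) (ha _), Real.sq_sqrt cConst_pos.le]

theorem symbol_apply_succAbove (i : Fin 2) {a : Fin 1 × Fin 2 → ℝ} (ha : ∀ j, a j ∈ coordSet 1) :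
    symbol i a (i.succAbove 0) = xi (a (0, 0)) (a (0, 1)) / √(1 + cConst) := by
  simp [symbol, localCoord, norm_xi (ha _) (ha _), Real.sq_sqrt cConst_pos.le]

theorem forall_fin_one_prod_fin_two {P : Fin 1 × Fin 2 → Prop} :
    (∀ j, P j) ↔ P (0, 0) ∧ P (0, 1) := by
  simp [Prod.forall, Fin.forall_fin_two]

/-- The constellation points are distinct: the cell index is that of the entry of larger modulus
(because `c < 1`), and the local coordinates are read off from the signs of the other entry. -/
theorem symbol_inj {i i' : Fin 2} {a a' : Fin 1 × Fin 2 → ℝ} (ha : ∀ j, a j ∈ coordSet 1)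
    (ha' : ∀ j, a' j ∈ coordSet 1) : symbol i a = symbol i' a' ↔ i = i' ∧ a = a' := by
  refine ⟨fun h => ?_, fun h => by rw [h.1, h.2]⟩
  have hc := cConst_pos
  have hden : (√(1 + cConst) : ℂ) ≠ 0 := by
    exact_mod_cast (Real.sqrt_pos.2 (by linarith)).ne'
  have hii : i = i' := by
    by_contra hne
    have hi : i = i'.succAbove 0 := by
      rcases Fin.eq_self_or_eq_succAbove i' i with h0 | ⟨j, hj⟩
      · exact absurd h0 hne
      · rw [hj, Subsingleton.elim j 0]
    have h1 := congrArg (fun v : EuclideanSpace ℂ (Fin 2) => v i) h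
    simp only at h1
    rw [symbol_apply_self i ha] at h1
    conv_rhs at h1 => rw [hi]
    rw [symbol_apply_succAbove i' ha', div_left_inj' hden] at h1
    have h2 := congrArg norm h1
    rw [norm_xi (ha' _) (ha' _), norm_one, eq_comm, Real.sqrt_eq_one] at h2
    exact cConst_lt_one.ne h2
  subst hii
  refine ⟨rfl, ?_⟩
  have h1 := congrArg (fun v : EuclideanSpace ℂ (Fin 2) => v (i.succAbove 0)) h
  simp only at h1
  rw [symbol_apply_succAbove i ha, symbol_apply_succAbove i ha', div_left_inj' hden,
    xi_eq (ha _) (ha _), xi_eq (ha' _) (ha' _)] at h1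
  have hc' : (√cConst : ℂ) ≠ 0 := by exact_mod_cast (Real.sqrt_pos.2 hc).ne'
  have h2 : (√2 : ℂ) ≠ 0 := by exact_mod_cast (Real.sqrt_pos.2 two_pos).ne'
  have h3 := (div_left_inj' h2).1 (mul_left_cancel₀ hc' h1)
  have hre := congrArg Complex.re h3
  have him := congrArg Complex.im h3
  simp at hre him
  exact funext (forall_fin_one_prod_fin_two.2
    ⟨coordSign_injective hre, coordSign_injective him⟩)

/-- Choosing the closest of `1/4` and `3/4` to `normalCDF w` amounts to reading off the sign of `w`,
as `normalCDF 0 = 1/2`. -/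
theorem coordSign_mul_pos_of_closest {w x : ℝ} (hw : w ≠ 0) (hx : x ∈ coordSet 1)
    (h : ∀ b ∈ coordSet 1, |normalCDF w - x| ≤ |normalCDF w - b|) : 0 < coordSign x * w := by
  have hiff : ∀ {v : ℝ}, normalCDF v ≤ 1 / 2 ↔ v ≤ 0 := fun {v} => by
    rw [← normalCDF_zero, strictMono_normalCDF.le_iff_le]
  have hiff' : ∀ {v : ℝ}, 1 / 2 ≤ normalCDF v ↔ 0 ≤ v := fun {v} => by
    rw [← normalCDF_zero, strictMono_normalCDF.le_iff_le]
  rcases mem_coordSet_one_iff.1 hx with rfl | rfl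
  · have h1 := h (3 / 4) (mem_coordSet_one_iff.2 (.inr rfl))
    have h2 : w < 0 := lt_of_le_of_ne (hiff.1 (by
      rw [← sq_le_sq] at h1; linarith)) hw
    norm_num [coordSign]; exact h2
  · have h1 := h (1 / 4) (mem_coordSet_one_iff.2 (.inl rfl))
    have h2 : 0 < w := lt_of_le_of_ne (hiff'.1 (by
      rw [← sq_le_sq] at h1; linarith)) hw.symm
    norm_num [coordSign]; exact h2

/-! ### The greedy decoder as a decision on the ratio of the samples -/

/-- With one receive antenna, the maximizing direction is that of the observation: this is the
equality case of the Cauchy-Schwarz inequality. -/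
theorem IsGreedyDecoding.exists_eq_smul {B : Fin 1 × Fin 2 → ℕ} {y : Matrix (Fin 2) (Fin 1) ℂ}
    {u : EuclideanSpace ℂ (Fin 2)} {iHat : Fin 2} {aHat : Fin 1 × Fin 2 → ℝ}
    (h : IsGreedyDecoding B y u iHat aHat) {k : Fin 2} (hy : y k 0 ≠ 0) :
    ∃ r : ℂ, r ≠ 0 ∧ ∀ k, u k = r * y k 0 := by
  set v : EuclideanSpace ℂ (Fin 2) := WithLp.toLp 2 fun k => y k 0 with hv
  have hv0 : v ≠ 0 := fun h0 => hy (congrArg (fun v : EuclideanSpace ℂ (Fin 2) => v k) h0)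
  have hinner : ∀ w : EuclideanSpace ℂ (Fin 2),
      ‖WithLp.toLp 2 (yᴴ *ᵥ w.ofLp)‖ = ‖inner ℂ v w‖ := by
    intro w
    rw [EuclideanSpace.norm_eq, Fintype.sum_unique, Real.sqrt_sq (norm_nonneg _),
      EuclideanSpace.inner_eq_star_dotProduct, dotProduct_comm]
    rfl
  have hvn : ‖v‖ ≠ 0 := norm_ne_zero_iff.2 hv0
  have hmax := h.isMax ((‖v‖⁻¹ : ℂ) • v) (by
    rw [norm_smul, norm_inv, Complex.norm_real, norm_norm, inv_mul_cancel₀ hvn])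
  rw [hinner, hinner, inner_smul_right, inner_self_eq_norm_sq_to_K, norm_mul, norm_inv,
    Complex.norm_real, norm_norm, norm_pow, RCLike.norm_ofReal, abs_norm] at hmax
  have hle : ‖v‖ ≤ ‖inner ℂ v u‖ := by
    calc ‖v‖ = ‖v‖⁻¹ * ‖v‖ ^ 2 := by field_simp
      _ ≤ _ := hmax
  have heq : ‖inner ℂ v u‖ = ‖v‖ * ‖u‖ :=
    le_antisymm (norm_inner_le_norm v u) (by rw [h.norm_eq, mul_one]; exact hle)
  have hu0 : u ≠ 0 := fun h0 => by simpa [h0] using h.norm_eq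
  obtain ⟨r, hr, hru⟩ := (norm_inner_eq_norm_iff (𝕜 := ℂ) hv0 hu0).1 heq
  exact ⟨r, hr, fun k => by rw [hru]; rfl⟩

theorem IsGreedyDecoding.norm_apply_le {B : Fin 1 × Fin 2 → ℕ} {y : Matrix (Fin 2) (Fin 1) ℂ}
    {u : EuclideanSpace ℂ (Fin 2)} {iHat : Fin 2} {aHat : Fin 1 × Fin 2 → ℝ}
    (h : IsGreedyDecoding B y u iHat aHat) (j : Fin 2) : ‖u j‖ ≤ ‖u iHat‖ := by
  have hle : ∀ k, ‖u k‖ ≤ 1 := fun k => h.norm_eq ▸ PiLp.norm_apply_le u k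
  have hc := h.cell j
  simp only [chordalDist, EuclideanSpace.inner_single_right, one_mul, RCLike.norm_conj] at hc
  rw [Real.sqrt_le_sqrt_iff (by nlinarith [hle j, norm_nonneg (u j)])] at hc
  exact le_of_sq_le_sq (by linarith) (norm_nonneg _)

/-- The cell is decoded correctly exactly when the ratio of the samples has modulus less
than `1`. -/
theorem IsGreedyDecoding.cell_eq_iff {B : Fin 1 × Fin 2 → ℕ} {y : Matrix (Fin 2) (Fin 1) ℂ}
    {u : EuclideanSpace ℂ (Fin 2)} {iHat : Fin 2} {aHat : Fin 1 × Fin 2 → ℝ}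
    (h : IsGreedyDecoding B y u iHat aHat) (i : Fin 2) (hy : y i 0 ≠ 0)
    (hne : ‖y (i.succAbove 0) 0 / y i 0‖ ≠ 1) :
    iHat = i ↔ ‖y (i.succAbove 0) 0 / y i 0‖ < 1 := by
  obtain ⟨r, hr, hu⟩ := h.exists_eq_smul hy
  have hle := h.norm_apply_le
  simp only [hu, norm_mul, mul_le_mul_iff_right₀ (norm_pos_iff.2 hr)] at hle
  rw [norm_div] at hne ⊢
  have hyi := norm_pos_iff.2 hy
  constructor
  · rintro rfl
    exact lt_of_le_of_ne ((div_le_one hyi).2 (hle _)) hne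
  · intro hlt
    rw [div_lt_one hyi] at hlt
    by_contra hni
    rcases Fin.eq_self_or_eq_succAbove i iHat with h0 | ⟨j, hj⟩
    · exact hni h0
    · rw [hj, Subsingleton.elim j 0] at hle
      exact (hle i).not_gt hlt

/-- The decoded coordinates are the signs of the real and imaginary parts of the ratio. -/
theorem IsGreedyDecoding.coordSign_mul_pos {y : Matrix (Fin 2) (Fin 1) ℂ}
    {u : EuclideanSpace ℂ (Fin 2)} {i : Fin 2} {aHat : Fin 1 × Fin 2 → ℝ}
    (h : IsGreedyDecoding (fun _ => 1) y u i aHat) (hy : y i 0 ≠ 0) {z : ℂ}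
    (hz : z = y (i.succAbove 0) 0 / y i 0)
    (hlt : ‖z‖ < 1) (hre : z.re ≠ 0) (him : z.im ≠ 0) :
    0 < coordSign (aHat (0, 0)) * z.re ∧ 0 < coordSign (aHat (0, 1)) * z.im := by
  obtain ⟨r, hr, hu⟩ := h.exists_eq_smul hy
  have ht : u (i.succAbove 0) / u i = z := by rw [hu, hu, mul_div_mul_left _ _ hr, hz]
  have hz0 : 0 < ‖z‖ := norm_pos_iff.2 fun h0 => hre (by simp [h0])
  have hk : 0 < √(2 * Real.log ((1 + ‖z‖ ^ 2) / (1 - ‖z‖ ^ 2))) / ‖z‖ := by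
    refine div_pos (Real.sqrt_pos.2 (mul_pos two_pos (Real.log_pos ?_))) hz0
    rw [one_lt_div (by nlinarith)]
    nlinarith
  set k := √(2 * Real.log ((1 + ‖z‖ ^ 2) / (1 - ‖z‖ ^ 2))) / ‖z‖ with hkdef
  have hw : (√(2 * Real.log ((1 + ‖z‖ ^ 2) / (1 - ‖z‖ ^ 2))) : ℂ) * (z / (‖z‖ : ℂ)) =
      (k : ℂ) * z := by
    rw [hkdef]; push_cast; ring
  have h0 : symbolInv i u (0, 0) = normalCDF (k * z.re) := by
    simp only [symbolInv, ht, hw, if_true, Complex.re_ofReal_mul]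
  have h1 : symbolInv i u (0, 1) = normalCDF (k * z.im) := by
    simp only [symbolInv, ht, hw, Complex.im_ofReal_mul]
    simp
  have hc0 := coordSign_mul_pos_of_closest (mul_ne_zero hk.ne' hre) (h.coord_mem (0, 0))
    (by rw [← h0]; exact h.coord_le (0, 0))
  have hc1 := coordSign_mul_pos_of_closest (mul_ne_zero hk.ne' him) (h.coord_mem (0, 1))
    (by rw [← h1]; exact h.coord_le (0, 1))
  rw [mul_left_comm] at hc0 hc1
  exact ⟨pos_of_mul_pos_right hc0 hk.le, pos_of_mul_pos_right hc1 hk.le⟩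

theorem eq_of_coordSign_mul_pos {x y w : ℝ} (hx : x ∈ coordSet 1) (hy : y ∈ coordSet 1)
    (h : 0 < coordSign x * w) (h' : 0 < coordSign y * w) : x = y := by
  rcases mem_coordSet_one_iff.1 hx with rfl | rfl <;>
    rcases mem_coordSet_one_iff.1 hy with rfl | rfl <;> norm_num [coordSign] at h h' ⊢ <;> linarith

/-- Away from the decision boundaries, the label is decoded correctly exactly when the ratio of
the samples lies in the quadrant of the unit disc selected by the transmitted coordinates. -/
theorem IsGreedyDecoding.correct_iff {y : Matrix (Fin 2) (Fin 1) ℂ}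
    {u : EuclideanSpace ℂ (Fin 2)} {iHat : Fin 2} {aHat : Fin 1 × Fin 2 → ℝ}
    (h : IsGreedyDecoding (fun _ => 1) y u iHat aHat) (i : Fin 2) {a : Fin 1 × Fin 2 → ℝ}
    (ha : ∀ j, a j ∈ coordSet 1) {z : ℂ} (hz : z = y (i.succAbove 0) 0 / y i 0)
    (hy : y i 0 ≠ 0) (hne : ‖z‖ ≠ 1) (hre : z.re ≠ 0) (him : z.im ≠ 0) :
    iHat = i ∧ aHat = a ↔
      ‖z‖ < 1 ∧ 0 < coordSign (a (0, 0)) * z.re ∧ 0 < coordSign (a (0, 1)) * z.im := by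
  have hcell := h.cell_eq_iff i hy (hz ▸ hne)
  rw [← hz] at hcell
  constructor
  · rintro ⟨rfl, rfl⟩
    exact ⟨hcell.1 rfl, h.coordSign_mul_pos hy hz (hcell.1 rfl) hre him⟩
  · rintro ⟨hlt, h0, h1⟩
    obtain rfl := hcell.2 hlt
    obtain ⟨h0', h1'⟩ := h.coordSign_mul_pos hy hz hlt hre him
    exact ⟨rfl, funext (forall_fin_one_prod_fin_two.2
      ⟨eq_of_coordSign_mul_pos (h.coord_mem _) (ha _) h0' h0,
        eq_of_coordSign_mul_pos (h.coord_mem _) (ha _) h1' h1⟩)⟩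

/-! ### From the channel to the error probabilities -/

instance isProbabilityMeasure_complexGaussian : IsProbabilityMeasure complexGaussian :=
  Measure.isProbabilityMeasure_map (by fun_prop)

/-- The joint law of the fading coefficient and the noise, for block length `2` and one antenna. -/
noncomputable def channelLaw : Measure ((Fin 1 → ℂ) × (Fin 2 → Fin 1 → ℂ)) :=
  (Measure.pi fun _ => complexGaussian).prod
    (Measure.pi fun _ => Measure.pi fun _ => complexGaussian)

/-- The three scalars that enter the observation, with the noise entry of the transmitted cell
listed first, are independent `CN(0,1)` variables. -/
theorem measurePreserving_channel (i : Fin 2) :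
    MeasurePreserving (fun p : (Fin 1 → ℂ) × (Fin 2 → Fin 1 → ℂ) =>
        (p.1 0, p.2 i 0, p.2 (i.succAbove 0) 0))
      channelLaw (complexGaussian.prod (complexGaussian.prod complexGaussian)) := by
  have h1 := measurePreserving_funUnique complexGaussian (Fin 1)
  have h2 := measurePreserving_piFinSuccAbove
    (fun _ : Fin 2 => Measure.pi fun _ : Fin 1 => complexGaussian) i
  have h3 := measurePreserving_funUnique (Measure.pi fun _ : Fin 1 => complexGaussian) (Fin 1)
  exact h1.prod ((h1.prod (h1.comp h3)).comp h2)

/-- The ratio of the received samples when the label `l` is sent: the sample outside the cell index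
`l.1` divided by the one at the cell index. It is `0` when the denominator vanishes, so a ratio with
nonzero real part has a nonzero denominator. -/
noncomputable def ratio (ρ : ℝ) (l : Fin 2 × (Fin 1 × Fin 2 → ℝ))
    (p : (Fin 1 → ℂ) × (Fin 2 → Fin 1 → ℂ)) : ℂ :=
  received ρ (symbol l.1 l.2) p.1 p.2 (l.1.succAbove 0) 0 /
    received ρ (symbol l.1 l.2) p.1 p.2 l.1 0

theorem measurable_ratio (ρ : ℝ) (l : Fin 2 × (Fin 1 × Fin 2 → ℝ)) : Measurable (ratio ρ l) := by
  unfold ratio received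
  simp only [Matrix.of_apply]
  fun_prop

theorem rhoZero_one (ρ : ℝ) : rhoZero 1 ρ = ρ * 2 / (1 + cConst) := by
  rw [rhoZero]; norm_num

theorem ratio_eq {ρ : ℝ} (hρ : 0 ≤ ρ) {l : Fin 2 × (Fin 1 × Fin 2 → ℝ)}
    (hl : ∀ j, l.2 j ∈ coordSet 1) (p : (Fin 1 → ℂ) × (Fin 2 → Fin 1 → ℂ)) :
    ratio ρ l p = (√(rhoZero 1 ρ) * xi (l.2 (0, 0)) (l.2 (0, 1)) * p.1 0
        + p.2 (l.1.succAbove 0) 0) / (√(rhoZero 1 ρ) * p.1 0 + p.2 l.1 0) := by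
  have hs : √(ρ * ((1 : ℕ) + 1)) = √(rhoZero 1 ρ) * √(1 + cConst) := by
    have := cConst_pos
    rw [rhoZero_one, ← Real.sqrt_mul (by positivity), div_mul_cancel₀ _ (by positivity)]
    norm_num
  have hden : (√(1 + cConst) : ℂ) ≠ 0 := by
    exact_mod_cast (Real.sqrt_pos.2 (by linarith [cConst_pos])).ne'
  simp only [ratio, received, Matrix.of_apply]
  rw [symbol_apply_self _ hl, symbol_apply_succAbove _ hl, hs]
  push_cast
  field_simp

theorem channelLaw_ratio {ρ : ℝ} (hρ : 0 ≤ ρ) {l : Fin 2 × (Fin 1 × Fin 2 → ℝ)}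
    (hl : ∀ j, l.2 j ∈ coordSet 1) {S : Set ℂ} (hS : MeasurableSet S) :
    channelLaw (ratio ρ l ⁻¹' S) = ∫⁻ z in S, ENNReal.ofReal
      (ratioDensity (rhoZero 1 ρ) (xi (l.2 (0, 0)) (l.2 (0, 1))) z) := by
  have hs : 0 ≤ rhoZero 1 ρ := by
    have := cConst_pos
    rw [rhoZero_one]; positivity
  have hJ : Measurable (S.indicator (1 : ℂ → ℝ≥0∞)) := measurable_one.indicator hS
  have h := lintegral_ratio hs (xi (l.2 (0, 0)) (l.2 (0, 1))) hJ
  rw [← (measurePreserving_channel l.1).lintegral_comp (by fun_prop)] at h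
  rw [← lintegral_indicator_one (measurable_ratio ρ l hS), ← lintegral_indicator hS]
  calc _ = _ := by
        refine lintegral_congr fun p => ?_
        rw [← ratio_eq hρ hl p]
        rfl
    _ = _ := h
    _ = _ := by
        refine lintegral_congr fun z => ?_
        by_cases hz : z ∈ S <;> simp [hz]

/-- Ties of the decoder occur only on a null set of ratios. -/
theorem volume_decision_boundary : volume {z : ℂ | ‖z‖ = 1 ∨ z.re = 0 ∨ z.im = 0} = 0 := by
  have h1 : volume {z : ℂ | ‖z‖ = 1} = 0 := by
    have : {z : ℂ | ‖z‖ = 1} = Metric.sphere 0 1 := by ext z; simp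
    rw [this, Measure.addHaar_sphere]
  have h2 : volume {z : ℂ | z.re = 0} = 0 := by
    have : {z : ℂ | z.re = 0} =
        Complex.measurableEquivRealProd ⁻¹' (({0} : Set ℝ) ×ˢ Set.univ) := by
      ext z; simp [Complex.measurableEquivRealProd_apply]
    rw [this, Complex.volume_preserving_equiv_real_prod.measure_preimage_equiv,
      Measure.volume_eq_prod, Measure.prod_prod, Real.volume_singleton, zero_mul]
  have h3 : volume {z : ℂ | z.im = 0} = 0 := by
    have : {z : ℂ | z.im = 0} =
        Complex.measurableEquivRealProd ⁻¹' (Set.univ ×ˢ ({0} : Set ℝ)) := by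
      ext z; simp [Complex.measurableEquivRealProd_apply]
    rw [this, Complex.volume_preserving_equiv_real_prod.measure_preimage_equiv,
      Measure.volume_eq_prod, Measure.prod_prod, Real.volume_singleton, mul_zero]
  exact measure_union_null h1 (measure_union_null h2 h3)

theorem finite_labels : (labels fun _ : Fin 1 × Fin 2 => 1).Finite := by
  have hfin : (coordSet 1).Finite :=
    (Set.toFinite {1 / 4, 3 / 4}).subset fun x hx => by
      simpa using mem_coordSet_one_iff.1 hx
  refine (Set.finite_univ.prod (Set.Finite.pi fun _ : Fin 1 × Fin 2 => hfin)).subset ?_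
  intro p hp
  exact ⟨trivial, fun j _ => hp j⟩

theorem nonempty_labels : (labels fun _ : Fin 1 × Fin 2 => 1).Nonempty :=
  ⟨(0, fun _ => 1 / 4), fun _ => mem_coordSet_one_iff.2 (.inl rfl)⟩

section Transmission

variable {Ω : Type*} [MeasurableSpace Ω] {μ : Measure Ω} {i : Ω → Fin 2}
  {a : Ω → Fin 1 × Fin 2 → ℝ} {h : Ω → Fin 1 → ℂ} {Z : Ω → Fin 2 → Fin 1 → ℂ}

theorem IsTransmission.ae_mem_labels (ht : IsTransmission μ (fun _ => 1) i a h Z) :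
    ∀ᵐ ω ∂μ, ∀ j, a ω j ∈ coordSet 1 := by
  have hm : MeasurableSet {p : (Fin 2 × (Fin 1 × Fin 2 → ℝ)) × ((Fin 1 → ℂ) × (Fin 2 → Fin 1 → ℂ)) |
      p.1 ∈ labels fun _ => 1} := measurable_fst finite_labels.measurableSet
  have := isProbabilityMeasure_uniformOn finite_labels nonempty_labels
  have hae : ∀ᵐ p ∂(μ.map fun ω => ((i ω, a ω), (h ω, Z ω))), p.1 ∈ labels fun _ => 1 := by
    rw [ht.law]
    refine Measure.quasiMeasurePreserving_fst.ae (p := fun l => l ∈ labels fun _ => 1) ?_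
    exact (mem_ae_iff_prob_eq_one finite_labels.measurableSet).2
      (uniformOn_self finite_labels nonempty_labels)
  exact (ae_map_iff ((ht.measurable_i.prodMk ht.measurable_a).prodMk
    (ht.measurable_h.prodMk ht.measurable_Z)).aemeasurable hm).1 hae

/-- If, for each label, the conditional probability of an event about the ratio has the same value
`p`, then `p` is its probability. The regions `S l` may depend on the label; no joint measurability
in `l` is required because the labels form a finite set. -/
theorem IsTransmission.measure_ratio_mem (ht : IsTransmission μ (fun _ => 1) i a h Z) {ρ : ℝ}
    (S : Fin 2 × (Fin 1 × Fin 2 → ℝ) → Set ℂ) (hS : ∀ l, MeasurableSet (S l)) {p : ℝ≥0∞}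
    (hp : ∀ l : Fin 2 × (Fin 1 × Fin 2 → ℝ), (∀ j, l.2 j ∈ coordSet 1) →
      channelLaw (ratio ρ l ⁻¹' S l) = p) :
    μ {ω | ratio ρ (i ω, a ω) (h ω, Z ω) ∈ S (i ω, a ω)} = p := by
  have hL := finite_labels
  have := isProbabilityMeasure_uniformOn hL nonempty_labels
  set L := labels fun _ : Fin 1 × Fin 2 => 1 with hLdef
  -- The event in the product space, restricted to the finitely many labels.
  set W := ⋃ l ∈ L, ({l} : Set (Fin 2 × (Fin 1 × Fin 2 → ℝ))) ×ˢ (ratio ρ l ⁻¹' S l) with hW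
  have hWm : MeasurableSet W := MeasurableSet.biUnion hL.countable fun l _ =>
    (measurableSet_singleton l).prod (measurable_ratio ρ l (hS l))
  have hmem : ∀ l ∈ L, ∀ q, (l, q) ∈ W ↔ ratio ρ l q ∈ S l := by
    intro l hl q
    simp only [hW, Set.mem_iUnion, Set.mem_prod, Set.mem_singleton_iff, Set.mem_preimage]
    constructor
    · rintro ⟨l', -, rfl, hq⟩
      exact hq
    · intro hq
      exact ⟨l, hl, rfl, hq⟩
  have hX : Measurable fun ω => ((i ω, a ω), (h ω, Z ω)) :=
    (ht.measurable_i.prodMk ht.measurable_a).prodMk (ht.measurable_h.prodMk ht.measurable_Z)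
  have haeL : ∀ᵐ l ∂(uniformOn L), l ∈ L :=
    (mem_ae_iff_prob_eq_one hL.measurableSet).2 (uniformOn_self hL nonempty_labels)
  calc _ = μ ((fun ω => ((i ω, a ω), (h ω, Z ω))) ⁻¹' W) := by
        refine measure_congr ?_
        filter_upwards [ht.ae_mem_labels] with ω hω
        exact propext (hmem (i ω, a ω) hω (h ω, Z ω)).symm
    _ = (uniformOn L).prod channelLaw W := by
        rw [← Measure.map_apply hX hWm, ht.law]
        rfl
    _ = ∫⁻ l, channelLaw (Prod.mk l ⁻¹' W) ∂(uniformOn L) := by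
        have : SFinite channelLaw := by unfold channelLaw; infer_instance
        exact Measure.prod_apply hWm
    _ = ∫⁻ _, p ∂(uniformOn L) := by
        refine lintegral_congr_ae (haeL.mono fun l hl => ?_)
        dsimp only
        rw [← hp l hl]
        congr 1
        ext q
        exact hmem l hl q
    _ = p := by simp

end Transmission

end CubeSplit

theorem corollary1 {Ω : Type*} [MeasurableSpace Ω] (μ : Measure Ω) [IsProbabilityMeasure μ]
    (ρ : ℝ) (hρ : 0 ≤ ρ)
    -- T = 2, N = 1, one bit per local coordinate
    (i : Ω → Fin 2) (a : Ω → Fin 1 × Fin 2 → ℝ)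
    (h : Ω → Fin 1 → ℂ) (Z : Ω → Fin 2 → Fin 1 → ℂ)
    (htrans : CubeSplit.IsTransmission μ (fun _ => 1) i a h Z)
    (u : Ω → EuclideanSpace ℂ (Fin 2)) (iHat : Ω → Fin 2) (aHat : Ω → Fin 1 × Fin 2 → ℝ)
    (hu : Measurable u) (hiHat : Measurable iHat) (haHat : Measurable aHat)
    (hdec : ∀ᵐ ω ∂μ, CubeSplit.IsGreedyDecoding (fun _ => 1)
      (CubeSplit.received ρ (CubeSplit.symbol (i ω) (a ω)) (h ω) (Z ω))
      (u ω) (iHat ω) (aHat ω))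
    (c r D E A₁ A₂ : ℝ)
    (hc : c = CubeSplit.cConst) (hr : r = CubeSplit.rhoZero 1 ρ)
    (hD : D = Real.sqrt ((2 + (1 + c) * r) ^ 2 - 4 * c * r ^ 2))
    (hE : E = Real.sqrt (1 + (1 + c) * r + c / 2 * r ^ 2))
    (hA₁ : A₁ = CubeSplit.arccot ((1 + (c - Real.sqrt (c / 2)) * r) / E))
    (hA₂ : A₂ = CubeSplit.arccot ((2 + (1 - 2 * Real.sqrt (2 * c) + c) * r) / D)) :
    -- the cell error probability
    CubeSplit.cellError μ i iHat = 1 / 2 * (1 - (1 - c) * r / D) ∧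
    -- the conditional coordinate error probability
    CubeSplit.coordError μ i a iHat aHat =
      1 - (1 + (1 - c) * r / D)⁻¹ *
        (1 / 4 + Real.sqrt (2 * c) * r * A₁ / (Real.pi * E)
          + (1 - c) * r * A₂ / (Real.pi * D)) ∧
    -- the union bound over the T - 1 = 1 coordinate pairs is tight
    CubeSplit.symbolError μ i a iHat aHat =
      CubeSplit.cellError μ i iHat
        + ∑ j : Fin 1, (1 - CubeSplit.cellError μ i iHat) *
            CubeSplit.pairError μ i a iHat aHat j ∧
    -- the symbol error probability, also as the probability of a wrong decoded symbol
    CubeSplit.symbolError μ i a iHat aHat =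
      7 / 8
        - Real.sqrt c * r * A₁ / (Real.pi * Real.sqrt (2 + 2 * (1 + c) * r + c * r ^ 2))
        - (1 - c) * r * A₂ / (2 * Real.pi * D) ∧
    μ.real {ω | CubeSplit.symbol (iHat ω) (aHat ω) ≠ CubeSplit.symbol (i ω) (a ω)} =
      CubeSplit.symbolError μ i a iHat aHat := by
  have hpi := Real.pi_pos
  have hc0 : 0 < c := hc ▸ CubeSplit.cConst_pos
  have hc1 : c < 1 := hc ▸ CubeSplit.cConst_lt_one
  have hr0 : 0 ≤ r := by
    rw [hr, CubeSplit.rhoZero_one, ← hc]; positivity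
  have hrad : 0 < (2 + (1 + c) * r) ^ 2 - 4 * c * r ^ 2 := by
    nlinarith [mul_nonneg hc0.le hr0, mul_nonneg hr0 hr0, sq_nonneg ((1 - c) * r)]
  have hD0 : 0 < D := hD ▸ Real.sqrt_pos.2 hrad
  have hE0 : 0 < E := hE ▸ Real.sqrt_pos.2 (by positivity)
  have hA₁0 : 0 ≤ A₁ := by
    rw [hA₁, CubeSplit.arccot]; exact (sub_pos.2 (Real.arctan_lt_pi_div_two _)).le
  have hA₂0 : 0 ≤ A₂ := by
    rw [hA₂, CubeSplit.arccot]; exact (sub_pos.2 (Real.arctan_lt_pi_div_two _)).le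
  have hc1' : 0 ≤ 1 - c := by linarith
  -- The probabilities that the cell, and that the whole label, is decoded correctly.
  set pCell := 1 / 2 * (1 + (1 - c) * r / D) with hpCell
  set pAll := 1 / 8 + Real.sqrt (2 * c) * r * A₁ / (2 * Real.pi * E)
        + (1 - c) * r * A₂ / (2 * Real.pi * D) with hpAll
  have hpCell0 : 0 < pCell := by positivity
  have hpAll0 : 0 ≤ pAll := by positivity
  have hnorm : ∀ l : Fin 2 × (Fin 1 × Fin 2 → ℝ), (∀ j, l.2 j ∈ CubeSplit.coordSet 1) →
      ‖CubeSplit.xi (l.2 (0, 0)) (l.2 (0, 1))‖ ^ 2 = c := fun l hl => by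
    rw [CubeSplit.norm_xi (hl _) (hl _), ← hc, Real.sq_sqrt hc0.le]
  have hball := htrans.measure_ratio_mem (ρ := ρ) (fun _ => {z : ℂ | ‖z‖ < 1})
    (fun _ => measurableSet_lt measurable_norm measurable_const) (p := ENNReal.ofReal pCell)
    (fun l hl => by
      rw [CubeSplit.channelLaw_ratio hρ hl (measurableSet_lt measurable_norm measurable_const),
        ← hr, CubeSplit.lintegral_ratioDensity_disc hr0 _ (hnorm l hl) hD]
      intro h0
      have := hnorm l hl
      rw [h0, norm_zero] at this
      exact hc0.ne (by linarith))
  have hSm : ∀ l : Fin 2 × (Fin 1 × Fin 2 → ℝ), MeasurableSet {z : ℂ | ‖z‖ < 1 ∧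
      0 < CubeSplit.coordSign (l.2 (0, 0)) * z.re ∧ 0 < CubeSplit.coordSign (l.2 (0, 1)) * z.im} :=
    fun l => by measurability
  have hsector := htrans.measure_ratio_mem (ρ := ρ)
    (fun l => {z : ℂ | ‖z‖ < 1 ∧ 0 < CubeSplit.coordSign (l.2 (0, 0)) * z.re ∧
      0 < CubeSplit.coordSign (l.2 (0, 1)) * z.im}) hSm (p := ENNReal.ofReal pAll)
    (fun l hl => by
      rw [CubeSplit.channelLaw_ratio hρ hl (hSm l), ← hr, CubeSplit.xi_eq (hl _) (hl _), ← hc,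
        CubeSplit.lintegral_ratioDensity_quadrant hr0 hc0.le (CubeSplit.coordSign_sq (hl _))
          (CubeSplit.coordSign_sq (hl _)) hD hE, ← hA₁, ← hA₂])
  have hN : MeasurableSet {z : ℂ | ‖z‖ = 1 ∨ z.re = 0 ∨ z.im = 0} := by measurability
  have hgen : ∀ᵐ ω ∂μ, CubeSplit.ratio ρ (i ω, a ω) (h ω, Z ω) ∉
      {z : ℂ | ‖z‖ = 1 ∨ z.re = 0 ∨ z.im = 0} := by
    have := htrans.measure_ratio_mem (ρ := ρ) (fun _ => {z : ℂ | ‖z‖ = 1 ∨ z.re = 0 ∨ z.im = 0})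
      (fun _ => hN) (p := 0) (fun l hl => by
        rw [CubeSplit.channelLaw_ratio hρ hl hN]
        exact setLIntegral_measure_zero _ _ CubeSplit.volume_decision_boundary)
    rw [ae_iff]
    simpa only [not_not] using this
  have hiff : ∀ᵐ ω ∂μ,
      (iHat ω = i ω ↔ ‖CubeSplit.ratio ρ (i ω, a ω) (h ω, Z ω)‖ < 1) ∧
      (iHat ω = i ω ∧ aHat ω = a ω ↔ ‖CubeSplit.ratio ρ (i ω, a ω) (h ω, Z ω)‖ < 1 ∧
        0 < CubeSplit.coordSign (a ω (0, 0)) * (CubeSplit.ratio ρ (i ω, a ω) (h ω, Z ω)).re ∧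
        0 < CubeSplit.coordSign (a ω (0, 1)) * (CubeSplit.ratio ρ (i ω, a ω) (h ω, Z ω)).im) := by
    filter_upwards [hdec, hgen, htrans.ae_mem_labels] with ω hω hg hl
    rw [not_or, not_or] at hg
    have hy : CubeSplit.received ρ (CubeSplit.symbol (i ω) (a ω)) (h ω) (Z ω) (i ω) 0 ≠ 0 := by
      intro h0
      exact hg.2.1 (by simp [CubeSplit.ratio, h0])
    exact ⟨hω.cell_eq_iff (i ω) hy hg.1, hω.correct_iff (i ω) hl rfl hy hg.1 hg.2.1 hg.2.2⟩
  have hmi := htrans.measurable_i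
  have hma := htrans.measurable_a
  have hcellm : MeasurableSet {ω | iHat ω = i ω} := measurableSet_eq_fun hiHat hmi
  have hallm : MeasurableSet {ω | iHat ω = i ω ∧ aHat ω = a ω} :=
    hcellm.inter (measurableSet_eq_fun haHat hma)
  have hcell : μ.real {ω | iHat ω = i ω} = pCell := by
    rw [Measure.real, ← ENNReal.toReal_ofReal hpCell0.le, ← hball]
    congr 1
    exact measure_congr (hiff.mono fun ω hω => propext hω.1)
  have hall : μ.real {ω | iHat ω = i ω ∧ aHat ω = a ω} = pAll := by
    rw [Measure.real, ← ENNReal.toReal_ofReal hpAll0, ← hsector]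
    congr 1
    exact measure_congr (hiff.mono fun ω hω => propext hω.2)
  have hcellError : CubeSplit.cellError μ i iHat = 1 - pCell := by
    rw [CubeSplit.cellError, ← hcell, ← probReal_compl_eq_one_sub hcellm]
    rfl
  have hcoordError : CubeSplit.coordError μ i a iHat aHat = 1 - pAll / pCell := by
    have hsub : {ω | iHat ω = i ω ∧ aHat ω = a ω} ⊆ {ω | iHat ω = i ω} := fun ω hω => hω.1
    have hdiff : {ω | iHat ω = i ω} ∩ {ω | aHat ω ≠ a ω} =
        {ω | iHat ω = i ω} \ {ω | iHat ω = i ω ∧ aHat ω = a ω} := by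
      ext ω
      simp only [Set.mem_inter_iff, Set.mem_ofPred_eq, Set.mem_sdiff]
      tauto
    rw [CubeSplit.coordError, Measure.real, cond_apply hcellm, ENNReal.toReal_mul,
      ENNReal.toReal_inv, ← Measure.real, ← Measure.real, hdiff,
      measureReal_sdiff hsub hallm, hcell, hall]
    field_simp
  have hpair : ∀ j, CubeSplit.pairError μ i a iHat aHat j =
      CubeSplit.coordError μ i a iHat aHat := by
    intro j
    rw [CubeSplit.pairError, CubeSplit.coordError]
    congr 1
    ext ω
    rw [Set.mem_ofPred_eq, Set.mem_ofPred_eq, not_iff_not, Prod.mk.injEq, funext_iff,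
      CubeSplit.forall_fin_one_prod_fin_two, Subsingleton.elim j 0]
  have hsymbolError : CubeSplit.symbolError μ i a iHat aHat = 1 - pAll := by
    rw [CubeSplit.symbolError, hcellError, hcoordError]
    field_simp
    ring
  refine ⟨?_, ?_, ?_, ?_, ?_⟩
  · rw [hcellError, hpCell]; ring
  · rw [hcoordError, hpCell, hpAll]
    congr 1
    field_simp
    ring
  · simp only [hpair, Fin.sum_univ_one]
    rfl
  · have h22 : √2 ^ 2 = 2 := Real.sq_sqrt (by norm_num)
    have e1 : Real.sqrt (2 + 2 * (1 + c) * r + c * r ^ 2) = √2 * E := by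
      rw [hE, ← Real.sqrt_mul (by norm_num)]
      congr 1
      ring
    rw [hsymbolError, hpAll, e1, Real.sqrt_mul (by norm_num)]
    field_simp
    linear_combination (-8 * √c * r * A₁ * D) * h22
  · rw [hsymbolError, ← hall, ← probReal_compl_eq_one_sub hallm]
    refine measureReal_congr ?_
    filter_upwards [hdec, htrans.ae_mem_labels] with ω hω hl
    refine propext ?_
    change ¬ _ ↔ ¬ _
    rw [CubeSplit.symbol_inj hω.coord_mem hl]
    rfl
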